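/- A monic real polynomial $P$ of degree $n$ is *realizable* if it is the characteristic polynomial of an entrywise nonnegative $n\times n$ matrix, i.e. of (the adjacency matrix of) a weighted digraph on $n$ vertices with positive arc weights; it is *irreducibly realizable* if the matrix can be chosen irreducible, i.e. the digraph strongly connected. A weighted digraph on the vertices $1,\dots,n$ is a *simple EBL digraph* if each arc $(i,i+1)$, $1\le i\le n-1$, is present with weight $1$, every other arc ends at vertex $1$ or starts at vertex $n$, and every cycle is, for some $1\le r\le n$, of the form $1,2,\dots,r,1$ or $n-r+1,\dots,n,n-r+1$. **Theorem.** Let $p\ge 3$, let $k_p,\dots,k_{2p+1}$ be real numbers, and let $$P(x)=x^{2p+1}+k_px^{p+1}+k_{p+1}x^{p}+\dots+k_{2p}x+k_{2p+1}\neq x^{2p+1}.$$ Consider the three configurations 1. $k_p<0$, $k_{p+1}<0$, $k_{p+2}=\dots=k_{2p}=0$ and $k_{2p+1}=k_pk_{p+1}$; 2. $k_p<0$, $k_{p+1}<0$, $k_{p+2}=\dots=k_{2p-1}=0$, $0<k_{2p}<\frac{k_p^2}{4}$ and $k_{2p+1}=k_{p+1}\left(\frac{k_p}{2}-\sqrt{\frac{k_p^2}{4}-k_{2p}}\right)$;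 3. $k_p<0$, $k_{p+1}=\dots=k_{2p-1}=k_{2p+1}=0$ and $k_{2p}=\frac{k_p^2}{4}$. If none of 1–3 holds, then $P$ is realizable if and only if it is irreducibly realizable. If one of 1–3 holds, then $P$ is realizable but not irreducibly realizable. Moreover, whenever $P$ is irreducibly realizable, it is the characteristic polynomial of a strongly connected simple EBL digraph. -/

import Mathlib

/-- A monic real polynomial `P` (of degree `n`) is realizable if it is the characteristic
polynomial of an entrywise nonnegative `n × n` matrix. Such matrices are exactly the adjacency
matrices of weighted digraphs on `n` vertices, with an arc `i → j` whenever `0 < A i j`. -/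
def Realizable (n : ℕ) (P : Polynomial ℝ) : Prop :=
  ∃ A : Matrix (Fin n) (Fin n) ℝ, (∀ i j, 0 ≤ A i j) ∧ A.charpoly = P

/-- `P` is irreducibly realizable if it is the characteristic polynomial of an irreducible
nonnegative `n × n` matrix, i.e. of a strongly connected weighted digraph
(`Matrix.IsIrreducible` includes entrywise nonnegativity). -/
def IrreduciblyRealizable (n : ℕ) (P : Polynomial ℝ) : Prop :=
  ∃ A : Matrix (Fin n) (Fin n) ℝ, A.IsIrreducible ∧ A.charpoly = P

/-- `c 0, c 1, …, c m, c 0` is a cycle (of length `m + 1`; a loop if `m = 0`) of the weighted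
digraph with adjacency matrix `A`: the vertices are distinct and consecutive ones, cyclically,
are joined by arcs. Addition in `Fin (m + 1)` is cyclic. -/
def IsDigraphCycle {n : ℕ} (A : Matrix (Fin n) (Fin n) ℝ) {m : ℕ} (c : Fin (m + 1) → Fin n) :
    Prop :=
  Function.Injective c ∧ ∀ s, 0 < A (c s) (c (s + 1))

/-- The weighted digraph on the vertices `0, 1, …, n - 1` with adjacency matrix `A` is a simple
EBL digraph. -/
structure IsSimpleEBL {n : ℕ} (A : Matrix (Fin n) (Fin n) ℝ) : Prop where
  nonneg : ∀ i j, 0 ≤ A i j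
  /-- The basic path `0 → 1 → ⋯ → n - 1` has all weights equal to one. -/
  path : ∀ i j : Fin n, (j : ℕ) = i + 1 → A i j = 1
  /-- Every other arc ends in the first vertex or starts in the last one. -/
  arcs : ∀ i j : Fin n, 0 < A i j → (j : ℕ) = i + 1 ∨ (j : ℕ) = 0 ∨ (i : ℕ) + 1 = n
  /-- Up to the choice of the starting vertex, every cycle of length `r = m + 1` is
  `0, 1, …, r - 1, 0` or `n - r, …, n - 1, n - r`. -/
  cycles : ∀ (m : ℕ) (c : Fin (m + 1) → Fin n), IsDigraphCycle A c →
    (∃ t, ∀ s, (c (t + s) : ℕ) = s) ∨ (∃ t, ∀ s, (c (t + s) : ℕ) + (m + 1) = n + s)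

/-- `x^(2p+1) + k_p x^(p+1) + k_(p+1) x^p + ⋯ + k_(2p) x + k_(2p+1)`; only the values
`k p, …, k (2 * p + 1)` matter. -/
noncomputable def oddGapPoly (p : ℕ) (k : ℕ → ℝ) : Polynomial ℝ :=
  Polynomial.X ^ (2 * p + 1) +
    ∑ j ∈ Finset.Icc p (2 * p + 1), Polynomial.C (k j) * Polynomial.X ^ (2 * p + 1 - j)

/-- The three exceptional coefficient configurations. -/
def ExceptionalCoeffs (p : ℕ) (k : ℕ → ℝ) : Prop :=
  (k p < 0 ∧ k (p + 1) < 0 ∧ (∀ j, p + 2 ≤ j → j ≤ 2 * p → k j = 0) ∧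
    k (2 * p + 1) = k p * k (p + 1)) ∨
  (k p < 0 ∧ k (p + 1) < 0 ∧ (∀ j, p + 2 ≤ j → j ≤ 2 * p - 1 → k j = 0) ∧
    0 < k (2 * p) ∧ k (2 * p) < k p ^ 2 / 4 ∧
    k (2 * p + 1) = k (p + 1) * (k p / 2 - √(k p ^ 2 / 4 - k (2 * p)))) ∨
  (k p < 0 ∧ (∀ j, p + 1 ≤ j → j ≤ 2 * p - 1 → k j = 0) ∧
    k (2 * p) = k p ^ 2 / 4 ∧ k (2 * p + 1) = 0)

/-! Put a = -k_p and b = -k_{p+1}. Expanding the determinant, k_j is the sum of the weights of all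
disjoint unions of cycles on j vertices, each with sign (-1)^(number of cycles). Since the
coefficients before k_p vanish, every cycle of a realizing digraph has length at least p. As 2p+1 <
3p, no three cycles are disjoint, and disjoint pairs affect only k_{2p} (lengths p, p) and k_{2p+1}
(lengths p, p+1).

Necessity: join two p-cycles when they are disjoint. This weighted graph is triangle-free, and the
p-cycles disjoint from a given (p+1)-cycle form an independent set. With α the maximal weight of an
independent set, a weighted Mantel argument gives k_{2p} ≤ α(a-α) and k_{2p+1} ≤ bα. These bounds
are `FeasibleCoeffs`.

Sufficiency: a feasible α is realized by putting a p-cycle of weight α at one end of an EBL digraph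
and the remaining cycles of length below 2p at the other. Slack in the two bounds becomes the weight
of cycles of lengths 2p and 2p+1. If k_{2p+1} ≤ ab/2, then α = a/2 is also feasible and all weights
below length 2p+1 can be split evenly. Slack or a suitable longer cycle makes the digraph strongly
connected; when both are missing, the coefficients are exceptional or all zero.

Exceptional case: every bound is tight, so only lengths p and p+1 occur, and equality in the Mantel
argument splits the cycles into two mutually disjoint families. An arc leaving the vertex set of one
family then lies on no cycle, which excludes strong connectivity (`not_isIrreducible_of_separated`).
-/

open Finset Polynomial

/-! ### A weighted Mantel inequality and its case of equality -/

section WeightedGraphs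

variable {ι : Type*}

/-- Sum of the products of weights over the `R`-related pairs in `F × G`. -/
noncomputable def relatedPairSum (R : ι → ι → Prop) (x : ι → ℝ) (F G : Finset ι) : ℝ :=
  open Classical in ∑ c ∈ F, ∑ d ∈ G, if R c d then x c * x d else 0

theorem relatedPairSum_comm {R : ι → ι → Prop} (hR : ∀ c d, R c d → R d c) (x : ι → ℝ)
    (F G : Finset ι) : relatedPairSum R x F G = relatedPairSum R x G F := by
  rw [relatedPairSum, sum_comm, relatedPairSum]
  refine sum_congr rfl fun c _ => sum_congr rfl fun d _ => ?_
  have h : R d c ↔ R c d := ⟨hR d c, hR c d⟩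
  by_cases hc : R c d
  · rw [if_pos hc, if_pos (h.mpr hc), mul_comm]
  · rw [if_neg hc, if_neg (mt h.mp hc)]

theorem relatedPairSum_eq_sum_mul (R : ι → ι → Prop) [DecidableRel R] (x : ι → ℝ)
    (F G : Finset ι) :
    relatedPairSum R x F G = ∑ c ∈ F, x c * ∑ d ∈ G with R c d, x d := by
  refine sum_congr rfl fun c _ => ?_
  rw [mul_sum, sum_filter]
  exact sum_congr rfl fun d _ => by congr

theorem relatedPairSum_union_left [DecidableEq ι] (R : ι → ι → Prop) (x : ι → ℝ)
    {F F' : Finset ι} (h : Disjoint F F') (G : Finset ι) :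
    relatedPairSum R x (F ∪ F') G = relatedPairSum R x F G + relatedPairSum R x F' G :=
  sum_union h

theorem relatedPairSum_union_right [DecidableEq ι] (R : ι → ι → Prop) (x : ι → ℝ)
    (F : Finset ι) {G G' : Finset ι} (h : Disjoint G G') :
    relatedPairSum R x F (G ∪ G') = relatedPairSum R x F G + relatedPairSum R x F G' := by
  simp only [relatedPairSum, sum_union h, sum_add_distrib]

/-- `I` is an independent subset of `F`, of maximal weight among these. -/
structure IsMaxIndependent (R : ι → ι → Prop) (x : ι → ℝ) (F I : Finset ι) : Prop where
  subset : I ⊆ F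
  indep : ∀ c ∈ I, ∀ d ∈ I, ¬ R c d
  weight_le : ∀ J ⊆ F, (∀ c ∈ J, ∀ d ∈ J, ¬ R c d) → ∑ c ∈ J, x c ≤ ∑ c ∈ I, x c

theorem exists_isMaxIndependent (R : ι → ι → Prop) (x : ι → ℝ) (F : Finset ι) :
    ∃ I, IsMaxIndependent R x F I := by
  classical
  obtain ⟨I, hI, hmax⟩ := exists_max_image
    (F.powerset.filter fun J => ∀ c ∈ J, ∀ d ∈ J, ¬ R c d) (fun J => ∑ c ∈ J, x c)
    ⟨∅, by simp⟩
  simp only [mem_filter, mem_powerset] at hI hmax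
  exact ⟨I, hI.1, hI.2, fun J hJ hJ' => hmax J ⟨hJ, hJ'⟩⟩

/-- The neighbours of a vertex of a triangle-free graph weigh at most as much as a maximal
independent set. -/
theorem IsMaxIndependent.sum_related_le {R : ι → ι → Prop} {x : ι → ℝ} {F I : Finset ι}
    [DecidableRel R] (hI : IsMaxIndependent R x F I) {c : ι}
    (htri : ∀ d ∈ F, ∀ e ∈ F, R c d → R c e → ¬ R d e) :
    ∑ d ∈ F with R c d, x d ≤ ∑ d ∈ I, x d := by
  refine hI.weight_le _ (filter_subset _ _) fun d hd e he => ?_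
  rw [mem_filter] at hd he
  exact htri d hd.1 e he.1 hd.2 he.2

theorem IsMaxIndependent.relatedPairSum_eq {R : ι → ι → Prop} {x : ι → ℝ} {F I : Finset ι}
    [DecidableEq ι] (hI : IsMaxIndependent R x F I) (hR : ∀ c d, R c d → R d c) :
    relatedPairSum R x F F =
      2 * relatedPairSum R x (F \ I) I + relatedPairSum R x (F \ I) (F \ I) := by
  have hF : F = I ∪ F \ I := (union_sdiff_of_subset hI.subset).symm
  have hd : Disjoint I (F \ I) := disjoint_sdiff
  have h0 : relatedPairSum R x I I = 0 :=
    sum_eq_zero fun c hc => sum_eq_zero fun d hd => if_neg (hI.indep c hc d hd)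
  conv_lhs => rw [hF, relatedPairSum_union_left R x hd, relatedPairSum_union_right R x _ hd,
    relatedPairSum_union_right R x _ hd, h0, relatedPairSum_comm hR x I]
  ring

/-- Merging the two sums on the left, each `c` outside `I` contributes its own weight times that of
its neighbours in `F`. Those neighbours are independent, hence weigh at most as much as `I`. -/
theorem IsMaxIndependent.relatedPairSum_sdiff_le {R : ι → ι → Prop} {x : ι → ℝ}
    {F I : Finset ι} [DecidableEq ι] (hI : IsMaxIndependent R x F I)
    (hx : ∀ c ∈ F, 0 < x c) (htri : ∀ c ∈ F, ∀ d ∈ F, ∀ e ∈ F, R c d → R c e → ¬ R d e) :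
    relatedPairSum R x (F \ I) I + relatedPairSum R x (F \ I) (F \ I) ≤
      (∑ c ∈ F \ I, x c) * ∑ c ∈ I, x c := by
  classical
  rw [← relatedPairSum_union_right R x _ disjoint_sdiff, union_sdiff_of_subset hI.subset,
    relatedPairSum_eq_sum_mul, sum_mul]
  refine sum_le_sum fun c hc => ?_
  have hcF := (mem_sdiff.mp hc).1
  exact mul_le_mul_of_nonneg_left (hI.sum_related_le (htri c hcF)) (hx c hcF).le

theorem relatedPairSum_nonneg {R : ι → ι → Prop} {x : ι → ℝ} {F G : Finset ι}
    (hF : ∀ c ∈ F, 0 < x c) (hG : ∀ c ∈ G, 0 < x c) : 0 ≤ relatedPairSum R x F G := by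
  classical
  refine sum_nonneg fun c hc => sum_nonneg fun d hd => ?_
  split_ifs
  · exact (mul_pos (hF c hc) (hG d hd)).le
  · exact le_rfl

theorem related_of_mul_le_relatedPairSum {R : ι → ι → Prop} {x : ι → ℝ} {F G : Finset ι}
    (hF : ∀ c ∈ F, 0 < x c) (hG : ∀ c ∈ G, 0 < x c)
    (h : (∑ c ∈ F, x c) * ∑ d ∈ G, x d ≤ relatedPairSum R x F G) :
    ∀ c ∈ F, ∀ d ∈ G, R c d := by
  classical
  intro c hc d hd
  by_contra hcd
  refine h.not_gt ?_
  rw [sum_mul_sum]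
  have hle : ∀ c ∈ F, ∀ d ∈ G, (if R c d then x c * x d else 0) ≤ x c * x d := by
    intro c hc d hd
    split_ifs
    · exact le_rfl
    · exact (mul_pos (hF c hc) (hG d hd)).le
  refine sum_lt_sum (fun c hc => sum_le_sum (hle c hc)) ⟨c, hc, ?_⟩
  refine sum_lt_sum (hle c hc) ⟨d, hd, ?_⟩
  rw [if_neg hcd]
  exact mul_pos (hF c hc) (hG d hd)

/-- The edge weight of a triangle-free graph is at most `α (a - α)`, where `a` is the total
weight and `α` the maximal weight of an independent set. -/
theorem IsMaxIndependent.relatedPairSum_le {R : ι → ι → Prop} {x : ι → ℝ} {F I : Finset ι}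
    (hI : IsMaxIndependent R x F I) (hR : ∀ c d, R c d → R d c)
    (hx : ∀ c ∈ F, 0 < x c) (htri : ∀ c ∈ F, ∀ d ∈ F, ∀ e ∈ F, R c d → R c e → ¬ R d e) :
    relatedPairSum R x F F ≤ 2 * ((∑ c ∈ I, x c) * (∑ c ∈ F, x c - ∑ c ∈ I, x c)) := by
  classical
  have h1 := hI.relatedPairSum_eq hR
  have h2 := hI.relatedPairSum_sdiff_le hx htri
  have hT : ∀ c ∈ F \ I, 0 < x c := fun c hc => hx c (mem_sdiff.mp hc).1
  have h3 : 0 ≤ relatedPairSum R x (F \ I) (F \ I) := relatedPairSum_nonneg hT hT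
  have h4 := sum_sdiff (f := x) hI.subset
  rw [← h4, add_sub_cancel_right]
  linarith

/-- In the case of equality of `IsMaxIndependent.relatedPairSum_le`, the maximal independent
set is completely joined to its complement. -/
theorem IsMaxIndependent.related_of_le {R : ι → ι → Prop} {x : ι → ℝ} {F I : Finset ι}
    [DecidableEq ι] (hI : IsMaxIndependent R x F I) (hR : ∀ c d, R c d → R d c)
    (hx : ∀ c ∈ F, 0 < x c) (htri : ∀ c ∈ F, ∀ d ∈ F, ∀ e ∈ F, R c d → R c e → ¬ R d e)
    (h : 2 * ((∑ c ∈ I, x c) * (∑ c ∈ F, x c - ∑ c ∈ I, x c)) ≤ relatedPairSum R x F F) :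
    ∀ c ∈ F \ I, ∀ d ∈ I, R c d := by
  have h1 := hI.relatedPairSum_eq hR
  have h2 := hI.relatedPairSum_sdiff_le hx htri
  have hT : ∀ c ∈ F \ I, 0 < x c := fun c hc => hx c (mem_sdiff.mp hc).1
  have h3 : 0 ≤ relatedPairSum R x (F \ I) (F \ I) := relatedPairSum_nonneg hT hT
  have h4 := sum_sdiff (f := x) hI.subset
  rw [← h4, add_sub_cancel_right] at h
  refine related_of_mul_le_relatedPairSum hT (fun c hc => hx c (hI.subset hc)) ?_
  linarith

end WeightedGraphs

/-! ### Characteristic polynomial coefficients as weights of permutations -/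

section CycleWeights

variable {ι : Type*} [Fintype ι] [DecidableEq ι]

/-- The product of the arc weights of the linear subdigraph formed by the nontrivial cycles
of `σ`. -/
def permWeight (A : Matrix ι ι ℝ) (σ : Equiv.Perm ι) : ℝ :=
  ∏ i ∈ σ.support, A i (σ i)

theorem permWeight_nonneg {A : Matrix ι ι ℝ} (hA : ∀ i j, 0 ≤ A i j) (σ : Equiv.Perm ι) :
    0 ≤ permWeight A σ :=
  prod_nonneg fun _ _ => hA _ _

theorem permWeight_mul (A : Matrix ι ι ℝ) {σ τ : Equiv.Perm ι} (h : σ.Disjoint τ) :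
    permWeight A (σ * τ) = permWeight A σ * permWeight A τ := by
  unfold permWeight
  rw [h.support_mul, prod_union (Equiv.Perm.disjoint_iff_disjoint_support.mp h)]
  congr 1
  · refine prod_congr rfl fun i hi => ?_
    rw [Equiv.Perm.mul_apply, (h i).resolve_left (Equiv.Perm.mem_support.mp hi)]
  · refine prod_congr rfl fun i hi => ?_
    rw [h.commute.eq, Equiv.Perm.mul_apply,
      (h i).resolve_right (Equiv.Perm.mem_support.mp hi)]

/-- Without loops a fixed point contributes exactly `X`, so each permutation yields a single
monomial and only moved points carry weight. -/
theorem prod_charmatrix_perm {A : Matrix ι ι ℝ} (hdiag : ∀ i, A i i = 0) (σ : Equiv.Perm ι) :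
    ∏ i, A.charmatrix i (σ i) =
      C ((-1) ^ #σ.support * permWeight A σ) * X ^ (Fintype.card ι - #σ.support) := by
  rw [← prod_sdiff (subset_univ σ.support), mul_comm]
  congr 1
  · rw [permWeight, map_mul, map_prod, map_pow, map_neg, map_one, ← prod_const,
      ← prod_mul_distrib]
    refine prod_congr rfl fun i hi => ?_
    rw [Matrix.charmatrix_apply_ne _ _ _ (Equiv.Perm.mem_support.mp hi).symm]
    ring
  · rw [← card_univ, ← card_sdiff_of_subset (subset_univ _), ← prod_const]
    refine prod_congr rfl fun i hi => ?_
    have : σ i = i := by simpa using hi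
    rw [this, Matrix.charmatrix_apply_eq, hdiag, map_zero, sub_zero]

/-- The signed contribution of a permutation to the characteristic polynomial. -/
def permTerm (A : Matrix ι ι ℝ) (σ : Equiv.Perm ι) : ℝ :=
  (Equiv.Perm.sign σ : ℤ) * (-1) ^ #σ.support * permWeight A σ

theorem charpoly_coeff_eq_sum_permTerm {A : Matrix ι ι ℝ} (hdiag : ∀ i, A i i = 0) {j : ℕ}
    (hj : j ≤ Fintype.card ι) :
    A.charpoly.coeff (Fintype.card ι - j) =
      ∑ σ : Equiv.Perm ι with #σ.support = j, permTerm A σ := by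
  rw [← Matrix.charpoly_transpose, Matrix.charpoly, Matrix.det_apply', finsetSum_coeff,
    sum_filter]
  refine sum_congr rfl fun σ _ => ?_
  have h1 : ∏ i, Matrix.charmatrix A.transpose (σ i) i = ∏ i, A.charmatrix i (σ i) := by
    rw [Matrix.charmatrix_transpose]; rfl
  rw [h1, prod_charmatrix_perm hdiag]
  have h2 : ((Equiv.Perm.sign σ : ℤ) : ℝ[X]) = C ((Equiv.Perm.sign σ : ℤ) : ℝ) := by simp
  rw [h2, ← mul_assoc, ← map_mul, coeff_C_mul, coeff_X_pow, permTerm]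
  have h3 : #σ.support ≤ Fintype.card ι := card_le_univ _
  by_cases h : #σ.support = j
  · simp [h, mul_assoc]
  · rw [if_neg h, if_neg (by omega), mul_zero]

theorem permTerm_of_isCycle (A : Matrix ι ι ℝ) {σ : Equiv.Perm ι} (h : σ.IsCycle) :
    permTerm A σ = -permWeight A σ := by
  rw [permTerm, h.sign]
  push_cast
  rw [neg_mul, ← pow_add, Even.neg_one_pow (by simp)]
  ring

theorem permTerm_mul (A : Matrix ι ι ℝ) {σ τ : Equiv.Perm ι} (h : σ.Disjoint τ) :
    permTerm A (σ * τ) = permTerm A σ * permTerm A τ := by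
  rw [permTerm, permTerm, permTerm, permWeight_mul A h, h.card_support_mul, Equiv.Perm.sign_mul]
  push_cast
  ring

theorem exists_cycle_factor {σ : Equiv.Perm ι} (h : σ ≠ 1) :
    ∃ c τ : Equiv.Perm ι, c.IsCycle ∧ c.Disjoint τ ∧ σ = c * τ := by
  obtain ⟨c, hc⟩ : σ.cycleFactorsFinset.Nonempty := by
    rw [nonempty_iff_ne_empty, Ne, Equiv.Perm.cycleFactorsFinset_eq_empty_iff]
    exact h
  have hd := Equiv.Perm.disjoint_mul_inv_of_mem_cycleFactorsFinset hc
  refine ⟨c, σ * c⁻¹, (Equiv.Perm.mem_cycleFactorsFinset_iff.mp hc).1, hd.symm, ?_⟩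
  rw [hd.symm.commute.eq]
  simp

/-- The cycles of length `j` of the digraph of `A`. -/
noncomputable def cyclesOfLength (A : Matrix ι ι ℝ) (j : ℕ) : Finset (Equiv.Perm ι) :=
  open Classical in univ.filter fun σ => σ.IsCycle ∧ #σ.support = j ∧ 0 < permWeight A σ

theorem mem_cyclesOfLength {A : Matrix ι ι ℝ} {j : ℕ} {σ : Equiv.Perm ι} :
    σ ∈ cyclesOfLength A j ↔ σ.IsCycle ∧ #σ.support = j ∧ 0 < permWeight A σ := by
  simp [cyclesOfLength]

/-- Every permutation of positive weight other than the identity moves at least `p` points. -/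
def HasGirth (A : Matrix ι ι ℝ) (p : ℕ) : Prop :=
  ∀ σ : Equiv.Perm ι, σ ≠ 1 → 0 < permWeight A σ → p ≤ #σ.support

/-- Induction on the number `j` of moved points. Once smaller nontrivial permutations have weight
zero, so do the non-cycles moving `j` points. The coefficient is then minus a sum of nonnegative
weights, and its vanishing kills each of them. -/
theorem hasGirth_of_charpoly_coeff {A : Matrix ι ι ℝ} (hA : ∀ i j, 0 ≤ A i j)
    (hdiag : ∀ i, A i i = 0) {p : ℕ} (hp : p ≤ Fintype.card ι)
    (hcoeff : ∀ j, 1 ≤ j → j < p → A.charpoly.coeff (Fintype.card ι - j) = 0) :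
    HasGirth A p := by
  suffices H : ∀ j < p, ∀ σ : Equiv.Perm ι, σ ≠ 1 → #σ.support = j → permWeight A σ = 0 by
    intro σ hσ hpos
    by_contra! hlt
    exact hpos.ne' (H _ hlt σ hσ rfl)
  intro j
  induction j using Nat.strong_induction_on with
  | _ j ih =>
    intro hj
    have hnoncycle : ∀ σ : Equiv.Perm ι, σ ≠ 1 → #σ.support = j → ¬ σ.IsCycle →
        permWeight A σ = 0 := by
      intro σ hσ hcard hncyc
      obtain ⟨c, τ, hc, hd, rfl⟩ := exists_cycle_factor hσ
      have hτ : τ ≠ 1 := by rintro rfl; exact hncyc (by simpa using hc)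
      have hτ' : 0 < #τ.support := card_pos.mpr
        (nonempty_iff_ne_empty.mpr (by simpa using hτ))
      rw [hd.card_support_mul] at hcard
      rw [permWeight_mul A hd, ih _ (by omega) (by omega) c hc.ne_one rfl, zero_mul]
    intro σ hσ hcard
    have hj1 : 1 ≤ j := by
      rw [← hcard]
      exact card_pos.mpr (nonempty_iff_ne_empty.mpr (by simpa using hσ))
    have hterm : ∀ τ ∈ univ.filter (fun τ : Equiv.Perm ι => #τ.support = j),
        permTerm A τ = -permWeight A τ := by
      intro τ hτ
      have hτc : #τ.support = j := by simpa using hτ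
      by_cases hcyc : τ.IsCycle
      · exact permTerm_of_isCycle A hcyc
      · have : permWeight A τ = 0 := by
          refine hnoncycle τ ?_ hτc hcyc
          rintro rfl
          simp at hτc
          omega
        simp [permTerm, this]
    have hsum := hcoeff j hj1 hj
    rw [charpoly_coeff_eq_sum_permTerm hdiag (by omega), sum_congr rfl hterm,
      sum_neg_distrib, neg_eq_zero,
      sum_eq_zero_iff_of_nonneg fun τ _ => permWeight_nonneg hA τ] at hsum
    exact hsum σ (by simpa using hcard)

/-- The permutations moving `j` points which have positive weight and are not cycles. -/
noncomputable def properLinear (A : Matrix ι ι ℝ) (j : ℕ) : Finset (Equiv.Perm ι) :=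
  open Classical in univ.filter fun σ => ¬ σ.IsCycle ∧ #σ.support = j ∧ 0 < permWeight A σ

theorem mem_properLinear {A : Matrix ι ι ℝ} {j : ℕ} {σ : Equiv.Perm ι} :
    σ ∈ properLinear A j ↔ ¬ σ.IsCycle ∧ #σ.support = j ∧ 0 < permWeight A σ := by
  simp [properLinear]

theorem charpoly_coeff_eq_cycles {A : Matrix ι ι ℝ} (hA : ∀ i j, 0 ≤ A i j)
    (hdiag : ∀ i, A i i = 0) {j : ℕ} (hj : j ≤ Fintype.card ι) :
    A.charpoly.coeff (Fintype.card ι - j) =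
      -(∑ σ ∈ cyclesOfLength A j, permWeight A σ) + ∑ σ ∈ properLinear A j, permTerm A σ := by
  classical
  rw [charpoly_coeff_eq_sum_permTerm hdiag hj, ← sum_filter_add_sum_filter_not _
    (fun σ : Equiv.Perm ι => σ.IsCycle), ← sum_neg_distrib]
  have hpos : ∀ σ : Equiv.Perm ι, permTerm A σ ≠ 0 → 0 < permWeight A σ := by
    intro σ h
    refine (permWeight_nonneg hA σ).lt_of_ne' fun h0 => h (by simp [permTerm, h0])
  congr 1
  · rw [← sum_congr rfl fun σ hσ => permTerm_of_isCycle A (mem_cyclesOfLength.mp hσ).1]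
    symm
    apply sum_subset
    · intro σ hσ
      simp [(mem_cyclesOfLength.mp hσ).1, (mem_cyclesOfLength.mp hσ).2.1]
    · intro σ hσ hσ'
      by_contra h
      simp only [mem_filter, mem_univ, true_and] at hσ
      exact hσ' (mem_cyclesOfLength.mpr ⟨hσ.2, hσ.1, hpos σ h⟩)
  · symm
    apply sum_subset
    · intro σ hσ
      simp [(mem_properLinear.mp hσ).1, (mem_properLinear.mp hσ).2.1]
    · intro σ hσ hσ'
      by_contra h
      simp only [mem_filter, mem_univ, true_and] at hσ
      exact hσ' (mem_properLinear.mpr ⟨hσ.2, hσ.1, hpos σ h⟩)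

/-- A third nontrivial factor would bring the number of moved points to at least `3 * p`. -/
theorem HasGirth.exists_factor_two {A : Matrix ι ι ℝ} {p : ℕ} (hg : HasGirth A p)
    (hA : ∀ i j, 0 ≤ A i j) (hp : Fintype.card ι < 3 * p) {σ : Equiv.Perm ι} (hσ : σ ≠ 1)
    (hncyc : ¬ σ.IsCycle) (hpos : 0 < permWeight A σ) :
    ∃ c d : Equiv.Perm ι, c.IsCycle ∧ d.IsCycle ∧ c.Disjoint d ∧ σ = c * d ∧
      0 < permWeight A c ∧ 0 < permWeight A d ∧ p ≤ #c.support ∧ p ≤ #d.support := by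
  have hfac : ∀ c τ : Equiv.Perm ι, c.Disjoint τ → 0 < permWeight A (c * τ) →
      0 < permWeight A c ∧ 0 < permWeight A τ := by
    intro c τ hd h
    rw [permWeight_mul A hd] at h
    exact ⟨pos_of_mul_pos_left h (permWeight_nonneg hA τ),
      pos_of_mul_pos_right h (permWeight_nonneg hA c)⟩
  obtain ⟨c, τ, hc, hd, rfl⟩ := exists_cycle_factor hσ
  have hτ : τ ≠ 1 := by rintro rfl; exact hncyc (by simpa using hc)
  obtain ⟨hwc, hwτ⟩ := hfac c τ hd hpos
  have hcp := hg c hc.ne_one hwc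
  refine ⟨c, τ, hc, ?_, hd, rfl, hwc, hwτ, hcp, hg τ hτ hwτ⟩
  by_contra hτc
  obtain ⟨d, ρ, hdc, hdρ, rfl⟩ := exists_cycle_factor hτ
  have hρ : ρ ≠ 1 := by rintro rfl; exact hτc (by simpa using hdc)
  obtain ⟨hwd, hwρ⟩ := hfac d ρ hdρ hwτ
  have h1 := hg d hdc.ne_one hwd
  have h2 := hg ρ hρ hwρ
  have h3 := card_le_univ (c * (d * ρ)).support
  rw [hd.card_support_mul, hdρ.card_support_mul] at h3
  omega

/-- Double counting: `m` is the number of ordered factorizations guaranteed for each member of `S`,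
two when both factors range over the same family and one for different lengths. -/
theorem mul_sum_permWeight_le_relatedPairSum {A : Matrix ι ι ℝ} (hA : ∀ i j, 0 ≤ A i j)
    {F G S : Finset (Equiv.Perm ι)} {m : ℕ}
    (hS : ∀ σ ∈ S, ∃ Q : Finset (Equiv.Perm ι × Equiv.Perm ι), m ≤ #Q ∧
      ∀ q ∈ Q, q.1 ∈ F ∧ q.2 ∈ G ∧ q.1.Disjoint q.2 ∧ q.1 * q.2 = σ) :
    m * ∑ σ ∈ S, permWeight A σ ≤ relatedPairSum Equiv.Perm.Disjoint (permWeight A) F G := by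
  classical
  set Q := (F ×ˢ G).filter fun q => q.1.Disjoint q.2 ∧ q.1 * q.2 ∈ S with hQ
  calc (m : ℝ) * ∑ σ ∈ S, permWeight A σ = ∑ σ ∈ S, m * permWeight A σ := mul_sum _ _ _
    _ ≤ ∑ σ ∈ S, ∑ q ∈ Q with q.1 * q.2 = σ, permWeight A q.1 * permWeight A q.2 := by
        refine sum_le_sum fun σ hσ => ?_
        obtain ⟨R, hm, hR⟩ := hS σ hσ
        have hsub : R ⊆ Q.filter fun q => q.1 * q.2 = σ := by
          intro q hq
          obtain ⟨h1, h2, h3, h4⟩ := hR q hq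
          simp [hQ, h1, h2, h3, h4, hσ]
        calc (m : ℝ) * permWeight A σ
            ≤ #(Q.filter fun q => q.1 * q.2 = σ) * permWeight A σ := by
              refine mul_le_mul_of_nonneg_right ?_ (permWeight_nonneg hA σ)
              exact_mod_cast hm.trans (card_le_card hsub)
          _ = ∑ q ∈ Q with q.1 * q.2 = σ, permWeight A σ := by simp
          _ ≤ _ := by
              refine (sum_congr rfl fun q hq => ?_).le
              simp only [hQ, mem_filter] at hq
              rw [← permWeight_mul A hq.1.2.1, hq.2]
    _ = ∑ q ∈ Q, permWeight A q.1 * permWeight A q.2 :=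
        sum_fiberwise_of_maps_to (fun q hq => (mem_filter.mp hq).2.2) _
    _ ≤ ∑ q ∈ (F ×ˢ G).filter fun q => q.1.Disjoint q.2,
          permWeight A q.1 * permWeight A q.2 := by
        refine sum_le_sum_of_subset_of_nonneg ?_ fun q _ _ =>
          mul_nonneg (permWeight_nonneg hA _) (permWeight_nonneg hA _)
        intro q hq
        simp only [hQ, mem_filter] at hq ⊢
        exact ⟨hq.1, hq.2.1⟩
    _ = relatedPairSum Equiv.Perm.Disjoint (permWeight A) F G := by
        rw [sum_filter, sum_product, relatedPairSum]

end CycleWeights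

/-! ### Strong connectivity and cycles through arcs -/

section Connectivity

theorem exists_nodup_chain {α : Type*} {r : α → α → Prop} {a b : α}
    (h : Relation.ReflTransGen r a b) :
    ∃ l : List α, l.IsChain r ∧ l.Nodup ∧ l.head? = some a ∧ l.getLast? = some b := by
  induction h using Relation.ReflTransGen.head_induction_on with
  | refl => exact ⟨[b], by simp⟩
  | @head a c hac _ ih =>
    obtain ⟨l, hch, hnd, hhead, hlast⟩ := ih
    by_cases ha : a ∈ l
    -- Loop erasure: if the new vertex already occurs in the chain, everything before that
    -- occurrence is discarded.
    · obtain ⟨s, t, rfl⟩ := List.append_of_mem ha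
      refine ⟨a :: t, hch.right_of_append, (List.nodup_append.mp hnd).2.1, rfl, ?_⟩
      rw [← hlast, List.getLast?_append]
      simp [List.getLast?_cons]
    · refine ⟨a :: l, ?_, List.nodup_cons.mpr ⟨ha, hnd⟩, rfl, ?_⟩
      · rw [List.isChain_cons]
        exact ⟨by simpa [hhead] using hac, hch⟩
      · simp [List.getLast?_cons, hlast]

theorem reflTransGen_of_isIrreducible {ι : Type*} {A : Matrix ι ι ℝ} (hA : A.IsIrreducible) (i j : ι) :
    Relation.ReflTransGen (fun i j => 0 < A i j) i j := by
  let : Quiver ι := A.toQuiver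
  obtain ⟨q, hq⟩ := hA.connected i j
  clear hq
  induction q with
  | nil => exact .refl
  | cons _ e ih => exact ih.tail e.down

variable {ι : Type*} [Fintype ι] [DecidableEq ι]

/-- A positive arc `u → v` between distinct vertices with a walk back from `v` to `u` lies on
a cycle. -/
theorem exists_cycle_through_arc {A : Matrix ι ι ℝ} {u v : ι} (huv : u ≠ v) (harc : 0 < A u v)
    (hback : Relation.ReflTransGen (fun i j => 0 < A i j) v u) :
    ∃ σ : Equiv.Perm ι, σ.IsCycle ∧ 0 < permWeight A σ ∧ u ∈ σ.support ∧ v ∈ σ.support := by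
  obtain ⟨l, hch, hnd, hhead, hlast⟩ := exists_nodup_chain hback
  have hv : v ∈ l := List.mem_of_head? hhead
  have hu : u ∈ l := List.mem_of_getLast? hlast
  have hlen : 2 ≤ l.length := by
    by_contra! hlt
    match l, hlt with
    | [], _ => simp at hv
    | [w], _ =>
      simp only [List.mem_singleton] at hv hu
      exact huv (hu.trans hv.symm)
  have hsupp : l.formPerm.support = l.toFinset :=
    List.support_formPerm_of_nodup l hnd (by rintro w rfl; simp at hlen)
  refine ⟨l.formPerm, List.isCycle_formPerm hnd hlen, prod_pos fun i hi => ?_, ?_, ?_⟩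
  · rw [hsupp, List.mem_toFinset] at hi
    obtain ⟨m, hm, rfl⟩ := List.getElem_of_mem hi
    rw [List.formPerm_apply_getElem l hnd m hm]
    by_cases hm' : m + 1 < l.length
    · simp only [Nat.mod_eq_of_lt hm']
      exact List.isChain_iff_getElem.mp hch m hm'
    · have hm1 : m + 1 = l.length := by omega
      have h1 : l[m] = u := by
        rw [List.getLast?_eq_getElem?] at hlast
        have : l.length - 1 = m := by omega
        rw [this, List.getElem?_eq_getElem hm] at hlast
        simpa using hlast
      have h2 : l[0] = v := by
        rw [List.head?_eq_getElem?, List.getElem?_eq_getElem (by omega)] at hhead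
        simpa using hhead
      simp only [hm1, Nat.mod_self, h1, h2]
      exact harc
  · simpa [hsupp] using hu
  · simpa [hsupp] using hv

theorem exists_boundary_arc {α : Type*} {r : α → α → Prop} {a b : α}
    (h : Relation.ReflTransGen r a b) {V : Set α} (ha : a ∈ V) (hb : b ∉ V) :
    ∃ u v, u ∈ V ∧ v ∉ V ∧ r u v := by
  by_contra! hcon
  refine hb ?_
  induction h with
  | refl => exact ha
  | @tail u v _ huv ih =>
    by_contra hv
    by_cases hu : u ∈ V
    · exact hcon u v hu hv huv
    · exact hu (ih hu)

/-- If the cycles split into two nonempty families such that every cycle of the first is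
disjoint from every cycle of the second, the digraph is not strongly connected. -/
theorem not_isIrreducible_of_separated {A : Matrix ι ι ℝ} {S : Finset (Equiv.Perm ι)}
    (hsep : ∀ σ : Equiv.Perm ι, σ.IsCycle → 0 < permWeight A σ → σ ∉ S →
      ∀ c ∈ S, c.Disjoint σ)
    {c d : Equiv.Perm ι} (hc : c ∈ S) (hcc : c.IsCycle) (hd : d ∉ S) (hdc : d.IsCycle)
    (hdw : 0 < permWeight A d) : ¬ A.IsIrreducible := by
  intro hirr
  have hne : ∀ σ : Equiv.Perm ι, σ.IsCycle → ∃ i, i ∈ σ.support := fun σ hσ =>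
    nonempty_iff_ne_empty.mpr (by simpa using hσ.ne_one)
  obtain ⟨i, hi⟩ := hne c hcc
  obtain ⟨j, hj⟩ := hne d hdc
  have hnot : ∀ σ : Equiv.Perm ι, σ.IsCycle → 0 < permWeight A σ → σ ∉ S →
      ∀ v ∈ σ.support, v ∉ {v | ∃ e ∈ S, v ∈ e.support} := by
    rintro σ hσ hw hS v hv ⟨e, he, hve⟩
    exact Finset.disjoint_left.mp
      (Equiv.Perm.disjoint_iff_disjoint_support.mp (hsep σ hσ hw hS e he)) hve hv
  obtain ⟨u, v, hu, hv, huv⟩ := exists_boundary_arc (reflTransGen_of_isIrreducible hirr i j)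
    (V := {v | ∃ e ∈ S, v ∈ e.support}) ⟨c, hc, hi⟩ (hnot d hdc hdw hd j hj)
  obtain ⟨σ, hσ, hw, huσ, hvσ⟩ := exists_cycle_through_arc
    (by rintro rfl; exact hv hu) huv (reflTransGen_of_isIrreducible hirr v u)
  by_cases hS : σ ∈ S
  · exact hv ⟨σ, hS, hvσ⟩
  · exact hnot σ hσ hw hS u huσ hu

end Connectivity

/-! ### Coefficients of a realizable polynomial in terms of cycles -/

section Coefficients

theorem oddGapPoly_coeff (p : ℕ) (k : ℕ → ℝ) {j : ℕ} (hj : 1 ≤ j) (hj' : j ≤ 2 * p + 1) :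
    (oddGapPoly p k).coeff (2 * p + 1 - j) = if p ≤ j then k j else 0 := by
  rw [oddGapPoly, coeff_add, coeff_X_pow, if_neg (by omega), zero_add, finsetSum_coeff]
  have h : ∀ i ∈ Icc p (2 * p + 1),
      (C (k i) * X ^ (2 * p + 1 - i)).coeff (2 * p + 1 - j) = if j = i then k i else 0 := by
    intro i hi
    rw [mem_Icc] at hi
    rw [coeff_C_mul, coeff_X_pow]
    by_cases hij : j = i
    · simp [hij]
    · rw [if_neg hij, if_neg (by omega), mul_zero]
  rw [sum_congr rfl h, sum_ite_eq]
  simp [mem_Icc, hj']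

variable {p : ℕ} {k : ℕ → ℝ} {A : Matrix (Fin (2 * p + 1)) (Fin (2 * p + 1)) ℝ}

theorem diag_eq_zero_of_charpoly_eq (hp : 3 ≤ p) (hA : ∀ i j, 0 ≤ A i j)
    (hch : A.charpoly = oddGapPoly p k) (i : Fin (2 * p + 1)) : A i i = 0 := by
  have h := A.trace_eq_neg_charpoly_coeff
  rw [Fintype.card_fin, hch, oddGapPoly_coeff p k le_rfl (by omega), if_neg (by omega),
    neg_zero, Matrix.trace] at h
  rw [sum_eq_zero_iff_of_nonneg fun i _ => by exact hA i i] at h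
  exact h i (mem_univ i)

theorem hasGirth_of_charpoly_eq (hp : 3 ≤ p) (hA : ∀ i j, 0 ≤ A i j)
    (hch : A.charpoly = oddGapPoly p k) : HasGirth A p := by
  refine hasGirth_of_charpoly_coeff hA (diag_eq_zero_of_charpoly_eq hp hA hch)
    (by rw [Fintype.card_fin]; omega) fun j hj hjp => ?_
  rw [hch, Fintype.card_fin, oddGapPoly_coeff p k hj (by omega), if_neg (by omega)]

theorem coeff_eq_cycles_add (hp : 3 ≤ p) (hA : ∀ i j, 0 ≤ A i j)
    (hch : A.charpoly = oddGapPoly p k) {j : ℕ} (hj : p ≤ j) (hj' : j ≤ 2 * p + 1) :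
    k j = -(∑ σ ∈ cyclesOfLength A j, permWeight A σ) +
      ∑ σ ∈ properLinear A j, permTerm A σ := by
  have h := charpoly_coeff_eq_cycles hA (diag_eq_zero_of_charpoly_eq hp hA hch)
    (j := j) (by rwa [Fintype.card_fin])
  rwa [hch, Fintype.card_fin, oddGapPoly_coeff p k (by omega) hj', if_pos hj] at h

theorem exists_factor_of_mem_properLinear (hp : 3 ≤ p) (hA : ∀ i j, 0 ≤ A i j)
    (hch : A.charpoly = oddGapPoly p k) {j : ℕ} (hj : p ≤ j)
    {σ : Equiv.Perm (Fin (2 * p + 1))} (hσ : σ ∈ properLinear A j) :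
    ∃ c d : Equiv.Perm (Fin (2 * p + 1)), c.IsCycle ∧ d.IsCycle ∧ c.Disjoint d ∧ σ = c * d ∧
      0 < permWeight A c ∧ 0 < permWeight A d ∧ p ≤ #c.support ∧ p ≤ #d.support ∧
      #c.support + #d.support = j := by
  obtain ⟨hncyc, hcard, hw⟩ := mem_properLinear.mp hσ
  have hσ1 : σ ≠ 1 := by rintro rfl; simp at hcard; omega
  obtain ⟨c, d, hc, hd, hcd, rfl, hwc, hwd, hcp, hdp⟩ :=
    (hasGirth_of_charpoly_eq hp hA hch).exists_factor_two hA
      (by rw [Fintype.card_fin]; omega) hσ1 hncyc hw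
  exact ⟨c, d, hc, hd, hcd, rfl, hwc, hwd, hcp, hdp, by rw [← hcd.card_support_mul, hcard]⟩

theorem permTerm_eq_of_mem_properLinear (hp : 3 ≤ p) (hA : ∀ i j, 0 ≤ A i j)
    (hch : A.charpoly = oddGapPoly p k) {j : ℕ} (hj : p ≤ j)
    {σ : Equiv.Perm (Fin (2 * p + 1))} (hσ : σ ∈ properLinear A j) :
    permTerm A σ = permWeight A σ := by
  obtain ⟨c, d, hc, hd, hcd, rfl, -⟩ := exists_factor_of_mem_properLinear hp hA hch hj hσ
  rw [permTerm_mul A hcd, permTerm_of_isCycle A hc, permTerm_of_isCycle A hd,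
    permWeight_mul A hcd, neg_mul_neg]

theorem coeff_eq_neg_sum_cycles (hp : 3 ≤ p) (hA : ∀ i j, 0 ≤ A i j)
    (hch : A.charpoly = oddGapPoly p k) {j : ℕ} (hj : p ≤ j) (hj' : j < 2 * p) :
    k j = -∑ σ ∈ cyclesOfLength A j, permWeight A σ := by
  have h0 : properLinear A j = ∅ := by
    refine eq_empty_of_forall_notMem fun σ hσ => ?_
    obtain ⟨c, d, -, -, -, -, -, -, h1, h2, h3⟩ :=
      exists_factor_of_mem_properLinear hp hA hch hj hσ
    omega
  rw [coeff_eq_cycles_add hp hA hch hj (by omega), h0, sum_empty, add_zero]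

theorem coeff_two_mul_le (hp : 3 ≤ p) (hA : ∀ i j, 0 ≤ A i j)
    (hch : A.charpoly = oddGapPoly p k) :
    2 * k (2 * p) ≤ -(2 * ∑ σ ∈ cyclesOfLength A (2 * p), permWeight A σ) +
      relatedPairSum Equiv.Perm.Disjoint (permWeight A)
        (cyclesOfLength A p) (cyclesOfLength A p) := by
  have hle : (2 : ℕ) * ∑ σ ∈ properLinear A (2 * p), permWeight A σ ≤
      relatedPairSum Equiv.Perm.Disjoint (permWeight A)
        (cyclesOfLength A p) (cyclesOfLength A p) := by
    refine mul_sum_permWeight_le_relatedPairSum hA fun σ hσ => ?_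
    obtain ⟨c, d, hc, hd, hcd, rfl, hwc, hwd, h1, h2, h3⟩ :=
      exists_factor_of_mem_properLinear hp hA hch (by omega) hσ
    have hcF : c ∈ cyclesOfLength A p := mem_cyclesOfLength.mpr ⟨hc, by omega, hwc⟩
    have hdF : d ∈ cyclesOfLength A p := mem_cyclesOfLength.mpr ⟨hd, by omega, hwd⟩
    have hne : c ≠ d := by
      rintro rfl
      exact hc.ne_one (Equiv.Perm.disjoint_refl_iff.mp hcd)
    -- Both orders occur in the double sum over `p`-cycles; this is the origin of the factor 2.
    refine ⟨{(c, d), (d, c)}, ?_, ?_⟩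
    · rw [card_pair (by simp [hne])]
    · intro q hq
      simp only [mem_insert, mem_singleton] at hq
      rcases hq with rfl | rfl
      · exact ⟨hcF, hdF, hcd, rfl⟩
      · exact ⟨hdF, hcF, hcd.symm, hcd.symm.commute.eq⟩
  have h := coeff_eq_cycles_add hp hA hch (j := 2 * p) (by omega) (by omega)
  rw [sum_congr rfl fun σ hσ => permTerm_eq_of_mem_properLinear hp hA hch (by omega) hσ] at h
  push_cast at hle
  linarith

theorem coeff_two_mul_add_one_le (hp : 3 ≤ p) (hA : ∀ i j, 0 ≤ A i j)
    (hch : A.charpoly = oddGapPoly p k) :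
    k (2 * p + 1) ≤ -(∑ σ ∈ cyclesOfLength A (2 * p + 1), permWeight A σ) +
      relatedPairSum Equiv.Perm.Disjoint (permWeight A)
        (cyclesOfLength A (p + 1)) (cyclesOfLength A p) := by
  have hle : (1 : ℕ) * ∑ σ ∈ properLinear A (2 * p + 1), permWeight A σ ≤
      relatedPairSum Equiv.Perm.Disjoint (permWeight A)
        (cyclesOfLength A (p + 1)) (cyclesOfLength A p) := by
    refine mul_sum_permWeight_le_relatedPairSum hA fun σ hσ => ?_
    obtain ⟨c, d, hc, hd, hcd, rfl, hwc, hwd, h1, h2, h3⟩ :=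
      exists_factor_of_mem_properLinear hp hA hch (by omega) hσ
    rcases h1.eq_or_lt with h | h
    · have hdG : d ∈ cyclesOfLength A (p + 1) := mem_cyclesOfLength.mpr ⟨hd, by omega, hwd⟩
      have hcF : c ∈ cyclesOfLength A p := mem_cyclesOfLength.mpr ⟨hc, h.symm, hwc⟩
      refine ⟨{(d, c)}, by simp, fun q hq => ?_⟩
      rw [mem_singleton] at hq
      subst hq
      exact ⟨hdG, hcF, hcd.symm, hcd.symm.commute.eq⟩
    · have hcG : c ∈ cyclesOfLength A (p + 1) := mem_cyclesOfLength.mpr ⟨hc, by omega, hwc⟩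
      have hdF : d ∈ cyclesOfLength A p := mem_cyclesOfLength.mpr ⟨hd, by omega, hwd⟩
      refine ⟨{(c, d)}, by simp, fun q hq => ?_⟩
      rw [mem_singleton] at hq
      subst hq
      exact ⟨hcG, hdF, hcd, rfl⟩
  have h := coeff_eq_cycles_add hp hA hch (j := 2 * p + 1) (by omega) le_rfl
  rw [sum_congr rfl fun σ hσ => permTerm_eq_of_mem_properLinear hp hA hch (by omega) hσ] at h
  push_cast at hle
  linarith

/-- Three disjoint supports would need `3 * p` vertices. Allowing `c` to be longer than `p` covers
both triangle-freeness and the neighbours of a `(p + 1)`-cycle. -/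
theorem not_disjoint_of_disjoint {c d e : Equiv.Perm (Fin (2 * p + 1))} (hp : 2 ≤ p)
    (hc : p ≤ #c.support) (hd : d ∈ cyclesOfLength A p) (he : e ∈ cyclesOfLength A p)
    (hcd : c.Disjoint d) (hce : c.Disjoint e) : ¬ d.Disjoint e := by
  intro hde
  have h := card_le_univ (c * (d * e)).support
  rw [(hcd.mul_right hce).card_support_mul, hde.card_support_mul, Fintype.card_fin,
    (mem_cyclesOfLength.mp hd).2.1, (mem_cyclesOfLength.mp he).2.1] at h
  omega

end Coefficients

/-! ### Necessary conditions and the exceptional configurations -/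

section Necessity

variable {p : ℕ} {k : ℕ → ℝ} {A : Matrix (Fin (2 * p + 1)) (Fin (2 * p + 1)) ℝ}

theorem weight_pos_of_mem_cyclesOfLength {j : ℕ} :
    ∀ c ∈ cyclesOfLength A j, 0 < permWeight A c :=
  fun _ hc => (mem_cyclesOfLength.mp hc).2.2

theorem sum_cyclesOfLength_nonneg (j : ℕ) : 0 ≤ ∑ c ∈ cyclesOfLength A j, permWeight A c :=
  sum_nonneg fun c hc => (weight_pos_of_mem_cyclesOfLength c hc).le

theorem cyclesOfLength_eq_empty {j : ℕ} (h : ∑ c ∈ cyclesOfLength A j, permWeight A c ≤ 0) :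
    cyclesOfLength A j = ∅ := by
  by_contra hne
  exact h.not_gt (sum_pos weight_pos_of_mem_cyclesOfLength (nonempty_iff_ne_empty.mpr hne))

theorem triangleFree_cyclesOfLength (hp : 2 ≤ p) : ∀ c ∈ cyclesOfLength A p,
    ∀ d ∈ cyclesOfLength A p, ∀ e ∈ cyclesOfLength A p,
      c.Disjoint d → c.Disjoint e → ¬ d.Disjoint e :=
  fun _ hc _ hd _ he => not_disjoint_of_disjoint hp (mem_cyclesOfLength.mp hc).2.1.ge hd he

theorem relatedPairSum_cyclesOfLength_succ_le (hp : 2 ≤ p)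
    {I : Finset (Equiv.Perm (Fin (2 * p + 1)))}
    (hI : IsMaxIndependent Equiv.Perm.Disjoint (permWeight A) (cyclesOfLength A p) I) :
    relatedPairSum Equiv.Perm.Disjoint (permWeight A)
        (cyclesOfLength A (p + 1)) (cyclesOfLength A p) ≤
      (∑ c ∈ cyclesOfLength A (p + 1), permWeight A c) * ∑ c ∈ I, permWeight A c := by
  classical
  rw [relatedPairSum_eq_sum_mul, sum_mul]
  refine sum_le_sum fun y hy => mul_le_mul_of_nonneg_left (hI.sum_related_le ?_)
    (weight_pos_of_mem_cyclesOfLength y hy).le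
  have := (mem_cyclesOfLength.mp hy).2.1
  exact fun d hd e he => not_disjoint_of_disjoint hp (by omega) hd he

/-- In the case of equality of `relatedPairSum_cyclesOfLength_succ_le`, the `p`-cycles disjoint
from a given `(p + 1)`-cycle form a maximal independent set. -/
theorem isMaxIndependent_of_mul_le_relatedPairSum (hp : 2 ≤ p)
    {I : Finset (Equiv.Perm (Fin (2 * p + 1)))}
    (hI : IsMaxIndependent Equiv.Perm.Disjoint (permWeight A) (cyclesOfLength A p) I)
    (h : (∑ c ∈ cyclesOfLength A (p + 1), permWeight A c) * ∑ c ∈ I, permWeight A c ≤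
      relatedPairSum Equiv.Perm.Disjoint (permWeight A)
        (cyclesOfLength A (p + 1)) (cyclesOfLength A p))
    [DecidableRel (Equiv.Perm.Disjoint (α := Fin (2 * p + 1)))]
    {y : Equiv.Perm (Fin (2 * p + 1))} (hy : y ∈ cyclesOfLength A (p + 1)) :
    IsMaxIndependent Equiv.Perm.Disjoint (permWeight A) (cyclesOfLength A p)
        {c ∈ cyclesOfLength A p | y.Disjoint c} ∧
      ∑ c ∈ cyclesOfLength A p with y.Disjoint c, permWeight A c =
        ∑ c ∈ I, permWeight A c := by
  have htri : ∀ y ∈ cyclesOfLength A (p + 1), ∀ d ∈ cyclesOfLength A p,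
      ∀ e ∈ cyclesOfLength A p, y.Disjoint d → y.Disjoint e → ¬ d.Disjoint e := by
    intro y hy d hd e he
    have := (mem_cyclesOfLength.mp hy).2.1
    exact not_disjoint_of_disjoint hp (by omega) hd he
  have hle : ∑ c ∈ I, permWeight A c ≤
      ∑ c ∈ cyclesOfLength A p with y.Disjoint c, permWeight A c := by
    by_contra! hlt
    refine h.not_gt ?_
    rw [relatedPairSum_eq_sum_mul, sum_mul]
    refine sum_lt_sum (fun z hz => mul_le_mul_of_nonneg_left (hI.sum_related_le (htri z hz))
      (weight_pos_of_mem_cyclesOfLength z hz).le) ⟨y, hy, ?_⟩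
    exact mul_lt_mul_of_pos_left hlt (weight_pos_of_mem_cyclesOfLength y hy)
  refine ⟨⟨filter_subset _ _, fun c hc d hd => ?_, fun J hJ hJ' =>
    (hI.weight_le J hJ hJ').trans hle⟩, (hI.sum_related_le (htri y hy)).antisymm hle⟩
  rw [mem_filter] at hc hd
  exact htri y hy c hc.1 d hd.1 hc.2 hd.2

/-- Necessary conditions on the coefficients of a realizable polynomial. -/
def FeasibleCoeffs (p : ℕ) (k : ℕ → ℝ) (α : ℝ) : Prop :=
  (∀ j, p ≤ j → j < 2 * p → k j ≤ 0) ∧ 0 ≤ α ∧ α ≤ -k p ∧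
    k (2 * p) ≤ α * (-k p - α) ∧ k (2 * p + 1) ≤ -k (p + 1) * α

theorem exists_feasibleCoeffs_of_charpoly_eq (hp : 3 ≤ p) (hA : ∀ i j, 0 ≤ A i j)
    (hch : A.charpoly = oddGapPoly p k) : ∃ α, FeasibleCoeffs p k α := by
  obtain ⟨I, hI⟩ := exists_isMaxIndependent Equiv.Perm.Disjoint (permWeight A)
    (cyclesOfLength A p)
  have ha := coeff_eq_neg_sum_cycles hp hA hch (j := p) le_rfl (by omega)
  have hb := coeff_eq_neg_sum_cycles hp hA hch (j := p + 1) (by omega) (by omega)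
  have h1 := coeff_two_mul_le hp hA hch
  have h2 := coeff_two_mul_add_one_le hp hA hch
  have h3 := hI.relatedPairSum_le (fun _ _ h => h.symm) weight_pos_of_mem_cyclesOfLength
    (triangleFree_cyclesOfLength (by omega))
  have h4 := relatedPairSum_cyclesOfLength_succ_le (by omega) hI
  have h5 := sum_cyclesOfLength_nonneg (A := A) (2 * p)
  have h6 := sum_cyclesOfLength_nonneg (A := A) (2 * p + 1)
  refine ⟨∑ c ∈ I, permWeight A c, fun j hj hj' => ?_, ?_, ?_, ?_, ?_⟩
  · rw [coeff_eq_neg_sum_cycles hp hA hch hj hj', neg_nonpos]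
    exact sum_cyclesOfLength_nonneg j
  · exact sum_nonneg fun c _ => permWeight_nonneg hA c
  · rw [ha, neg_neg]
    exact sum_le_sum_of_subset_of_nonneg hI.subset fun c _ _ => permWeight_nonneg hA c
  · rw [ha, neg_neg]
    linarith
  · rw [hb, neg_neg]
    linarith

/-- Below length `2 * p` a zero coefficient excludes cycles of that length, since no pairs
contribute there; the top two lengths need the separate hypotheses. -/
theorem mem_cyclesOfLength_of_gap (hp : 3 ≤ p) (hA : ∀ i j, 0 ≤ A i j)
    (hch : A.charpoly = oddGapPoly p k) (hmid : ∀ j, p + 2 ≤ j → j ≤ 2 * p - 1 → k j = 0)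
    (h2p : ∑ c ∈ cyclesOfLength A (2 * p), permWeight A c ≤ 0)
    (h2p1 : ∑ c ∈ cyclesOfLength A (2 * p + 1), permWeight A c ≤ 0)
    {σ : Equiv.Perm (Fin (2 * p + 1))} (hσ : σ.IsCycle) (hw : 0 < permWeight A σ) :
    σ ∈ cyclesOfLength A p ∨ σ ∈ cyclesOfLength A (p + 1) := by
  have hmem : ∀ j, #σ.support = j → σ ∈ cyclesOfLength A j :=
    fun j hj => mem_cyclesOfLength.mpr ⟨hσ, hj, hw⟩
  have hge : p ≤ #σ.support := hasGirth_of_charpoly_eq hp hA hch σ hσ.ne_one hw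
  have hle : #σ.support ≤ 2 * p + 1 := by simpa using card_le_univ σ.support
  by_contra! hcon
  have h1 : #σ.support ≠ p := fun h => hcon.1 (hmem _ h)
  have h2 : #σ.support ≠ p + 1 := fun h => hcon.2 (hmem _ h)
  have hempty : cyclesOfLength A #σ.support = ∅ := by
    apply cyclesOfLength_eq_empty
    rcases lt_or_ge #σ.support (2 * p) with h | h
    · have h3 := coeff_eq_neg_sum_cycles hp hA hch hge h
      rw [hmid _ (by omega) (by omega)] at h3
      linarith
    · rcases h.eq_or_lt with h | h
      · rwa [← h]
      · rwa [show #σ.support = 2 * p + 1 by omega]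
  have := hmem _ rfl
  rw [hempty] at this
  simp at this

/-- Handles the first two configurations at once. The bound on `k (2 * p + 1)` forces `s ≤ α` and
the one on `k (2 * p)` forces `α ≤ s`, so all estimates are equalities. For a fixed `(p + 1)`-cycle
`y`, the `p`-cycles disjoint from `y` are then disjoint from every other cycle. -/
theorem not_isIrreducible_of_coeff_succ_neg (hp : 3 ≤ p) (hch : A.charpoly = oddGapPoly p k)
    {s : ℝ} (hb : k (p + 1) < 0) (hmid : ∀ j, p + 2 ≤ j → j ≤ 2 * p - 1 → k j = 0)
    (hs : -k p < 2 * s) (h2p : k (2 * p) = s * (-k p - s))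
    (h2p1 : k (2 * p + 1) = -k (p + 1) * s) : ¬ A.IsIrreducible := by
  classical
  intro hirr
  have hA := hirr.nonneg
  obtain ⟨I, hI⟩ := exists_isMaxIndependent Equiv.Perm.Disjoint (permWeight A)
    (cyclesOfLength A p)
  have htri := triangleFree_cyclesOfLength (A := A) (p := p) (by omega)
  have ha := coeff_eq_neg_sum_cycles hp hA hch (j := p) le_rfl (by omega)
  have hbG := coeff_eq_neg_sum_cycles hp hA hch (j := p + 1) (by omega) (by omega)
  have h1 := coeff_two_mul_le hp hA hch
  have h2 := coeff_two_mul_add_one_le hp hA hch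
  have h3 := hI.relatedPairSum_le (fun _ _ h => h.symm) weight_pos_of_mem_cyclesOfLength htri
  have h4 := relatedPairSum_cyclesOfLength_succ_le (by omega) hI
  have h5 := sum_cyclesOfLength_nonneg (A := A) (2 * p)
  have h6 := sum_cyclesOfLength_nonneg (A := A) (2 * p + 1)
  have h7 := sum_cyclesOfLength_nonneg (A := A) p
  obtain ⟨y, hy⟩ : (cyclesOfLength A (p + 1)).Nonempty := by
    rw [nonempty_iff_ne_empty]
    intro h
    rw [h, sum_empty, neg_zero] at hbG
    linarith
  set a := ∑ c ∈ cyclesOfLength A p, permWeight A c with ha_def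
  set b := ∑ c ∈ cyclesOfLength A (p + 1), permWeight A c with hb_def
  set α := ∑ c ∈ I, permWeight A c with hα
  rw [ha, neg_neg] at h2p hs
  rw [hbG, neg_neg] at h2p1
  have hbpos : 0 < b := by linarith
  have hle : s ≤ α := by
    refine le_of_mul_le_mul_left ?_ hbpos
    linarith
  have hαs : α = s := by
    refine le_antisymm ?_ hle
    by_contra! hlt
    -- `x * (a - x)` decreases strictly beyond `a / 2`, and `s` already lies there.
    nlinarith [mul_pos (sub_pos.mpr hlt) (show 0 < α + s - a by linarith)]
  have hgap := fun σ => mem_cyclesOfLength_of_gap (σ := σ) hp hA hch hmid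
    (by rw [hαs] at h3; linarith) (by rw [hαs] at h4; linarith)
  have hmax := fun y hy => isMaxIndependent_of_mul_le_relatedPairSum (A := A) (y := y)
    (by omega) hI (by rw [← hα, ← hb_def, hαs]; linarith) hy
  have hjoin : ∀ y ∈ cyclesOfLength A (p + 1), ∀ c ∈ cyclesOfLength A p, ¬ y.Disjoint c →
      ∀ d ∈ cyclesOfLength A p, y.Disjoint d → c.Disjoint d := by
    intro y hy c hc hyc d hd hyd
    refine (hmax y hy).1.related_of_le (fun _ _ h => h.symm) weight_pos_of_mem_cyclesOfLength
      htri ?_ c (by simp [hc, hyc]) d (by simp [hd, hyd])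
    rw [(hmax y hy).2, ← hα, ← ha_def, hαs]
    linarith
  have hspos : 0 < s := by linarith
  -- Two families of weight `s > a / 2` inside a total of `a` must overlap.
  have hcommon : ∀ z ∈ cyclesOfLength A (p + 1), ∃ e ∈ cyclesOfLength A p,
      y.Disjoint e ∧ z.Disjoint e := by
    intro z hz
    by_contra! hcon
    have hdisj : Disjoint {c ∈ cyclesOfLength A p | y.Disjoint c}
        {c ∈ cyclesOfLength A p | z.Disjoint c} := by
      rw [Finset.disjoint_left]
      intro e he he'
      rw [mem_filter] at he he'
      exact hcon e he.1 he.2 he'.2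
    have hsub := sum_le_sum_of_subset_of_nonneg (f := permWeight A)
      (union_subset (filter_subset (fun c => y.Disjoint c) (cyclesOfLength A p))
        (filter_subset (fun c => z.Disjoint c) (cyclesOfLength A p)))
      fun c _ _ => permWeight_nonneg hA c
    rw [sum_union hdisj, (hmax y hy).2, (hmax z hz).2, ← hα, ← ha_def] at hsub
    linarith
  obtain ⟨c, hc, hyc, -⟩ := hcommon y hy
  refine not_isIrreducible_of_separated (A := A)
    (S := {c ∈ cyclesOfLength A p | y.Disjoint c}) ?_ (c := c) (d := y) (by simp [hc, hyc])
    (mem_cyclesOfLength.mp hc).1 ?_ (mem_cyclesOfLength.mp hy).1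
    (mem_cyclesOfLength.mp hy).2.2 hirr
  · intro σ hσ hw hσS d hd
    rw [mem_filter] at hσS hd
    rcases hgap σ hσ hw with h | h
    · exact (hjoin y hy σ h (fun h' => hσS ⟨h, h'⟩) d hd.1 hd.2).symm
    · by_contra hσd
      -- If `σ` met `d`, then `d` would be joined to `e`, making `y`, `d`, `e` three disjoint
      -- cycles.
      obtain ⟨e, he, hye, hσe⟩ := hcommon σ h
      have hde := hjoin σ h d hd.1 (fun h' => hσd h'.symm) e he hσe
      exact not_disjoint_of_disjoint (c := y) (by omega)
        (by rw [(mem_cyclesOfLength.mp hy).2.1]; omega) hd.1 he hd.2 hye hde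
  · intro hmem
    have h1 := (mem_cyclesOfLength.mp (mem_filter.mp hmem).1).2.1
    have h2 := (mem_cyclesOfLength.mp hy).2.1
    omega

/-- Here `α * (a - α)` must reach its maximum, so `α = a / 2`, and a maximal independent set and its
complement are two nonempty, mutually disjoint families containing all cycles. -/
theorem not_isIrreducible_of_coeff_two_mul_eq (hp : 3 ≤ p) (hch : A.charpoly = oddGapPoly p k)
    (ha : k p < 0) (hmid : ∀ j, p + 1 ≤ j → j ≤ 2 * p - 1 → k j = 0)
    (h2p : k (2 * p) = k p ^ 2 / 4) (h2p1 : k (2 * p + 1) = 0) : ¬ A.IsIrreducible := by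
  classical
  intro hirr
  have hA := hirr.nonneg
  obtain ⟨I, hI⟩ := exists_isMaxIndependent Equiv.Perm.Disjoint (permWeight A)
    (cyclesOfLength A p)
  have htri := triangleFree_cyclesOfLength (A := A) (p := p) (by omega)
  have haF := coeff_eq_neg_sum_cycles hp hA hch (j := p) le_rfl (by omega)
  have hbG := coeff_eq_neg_sum_cycles hp hA hch (j := p + 1) (by omega) (by omega)
  have h1 := coeff_two_mul_le hp hA hch
  have h2 := coeff_two_mul_add_one_le hp hA hch
  have h3 := hI.relatedPairSum_le (fun _ _ h => h.symm) weight_pos_of_mem_cyclesOfLength htri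
  have h5 := sum_cyclesOfLength_nonneg (A := A) (2 * p)
  have hG : cyclesOfLength A (p + 1) = ∅ := by
    apply cyclesOfLength_eq_empty
    rw [hmid (p + 1) le_rfl (by omega)] at hbG
    linarith
  rw [hG] at h2
  simp only [relatedPairSum, sum_empty, add_zero] at h2
  have h4 := sum_sdiff (f := permWeight A) hI.subset
  set a := ∑ c ∈ cyclesOfLength A p, permWeight A c with ha_def
  set α := ∑ c ∈ I, permWeight A c with hα
  rw [haF] at h2p
  have hαa : α = a / 2 := by
    have : (α - a / 2) ^ 2 ≤ 0 := by nlinarith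
    have := pow_eq_zero_iff (two_ne_zero) |>.mp (this.antisymm (sq_nonneg _))
    linarith
  have hsq : 2 * (α * (a - α)) = 2 * k (2 * p) := by rw [hαa, h2p]; ring
  have hgap := fun σ => mem_cyclesOfLength_of_gap (σ := σ) hp hA hch
    (fun j hj => hmid j (by omega)) (by linarith) (by linarith)
  have hjoin := hI.related_of_le (fun _ _ h => h.symm) weight_pos_of_mem_cyclesOfLength htri
    (by rw [← hα, ← ha_def]; linarith)
  obtain ⟨c, hc⟩ : I.Nonempty := by
    rw [nonempty_iff_ne_empty]
    intro h
    rw [h, sum_empty] at hα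
    linarith
  obtain ⟨d, hd⟩ : (cyclesOfLength A p \ I).Nonempty := by
    rw [nonempty_iff_ne_empty]
    intro h
    rw [h, sum_empty] at h4
    linarith
  rw [mem_sdiff] at hd
  refine not_isIrreducible_of_separated (A := A) (S := I) ?_ hc
    (mem_cyclesOfLength.mp (hI.subset hc)).1 hd.2 (mem_cyclesOfLength.mp hd.1).1
    (mem_cyclesOfLength.mp hd.1).2.2 hirr
  intro σ hσ hw hσI e he
  rcases hgap σ hσ hw with h | h
  · exact (hjoin σ (mem_sdiff.mpr ⟨h, hσI⟩) e he).symm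
  · rw [hG] at h
    simp at h

end Necessity

/-! ### EBL digraphs: cycles and strong connectivity -/

section SimpleEBL

/-- The digraph with the path `0 → 1 → ⋯ → n - 1`, an arc of weight `u r` from the `r`-th vertex
to the first one and an arc of weight `v r` from the last vertex to the `r`-th last one. -/
def eblMatrix (n : ℕ) (u v : ℕ → ℝ) : Matrix (Fin n) (Fin n) ℝ := fun i j =>
  (if (j : ℕ) = i + 1 then 1 else 0) + (if (j : ℕ) = 0 then u (i + 1) else 0) +
    if (i : ℕ) + 1 = n then v (n - j) else 0

variable {n : ℕ} {u v : ℕ → ℝ}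

theorem eblMatrix_nonneg (hu : ∀ r, 0 ≤ u r) (hv : ∀ r, 0 ≤ v r) (i j : Fin n) :
    0 ≤ eblMatrix n u v i j := by
  have h1 := hu (i + 1)
  have h2 := hv (n - j)
  unfold eblMatrix
  split_ifs <;> linarith

theorem eblMatrix_succ (i j : Fin n) (h : (j : ℕ) = i + 1) : eblMatrix n u v i j = 1 := by
  have := j.isLt
  unfold eblMatrix
  rw [if_pos h, if_neg (by omega), if_neg (by omega), add_zero, add_zero]

theorem eq_succ_or_of_eblMatrix_pos (i j : Fin n) (h : 0 < eblMatrix n u v i j) :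
    (j : ℕ) = i + 1 ∨ (j : ℕ) = 0 ∨ (i : ℕ) + 1 = n := by
  by_contra! hcon
  unfold eblMatrix at h
  rw [if_neg hcon.1, if_neg hcon.2.1, if_neg hcon.2.2] at h
  simp at h

/-- The condition on the arcs of a simple EBL digraph implies the one on its cycles. -/
theorem cycle_form_of_arcs {A : Matrix (Fin n) (Fin n) ℝ}
    (harcs : ∀ i j : Fin n, 0 < A i j → (j : ℕ) = i + 1 ∨ (j : ℕ) = 0 ∨ (i : ℕ) + 1 = n)
    (m : ℕ) (c : Fin (m + 1) → Fin n) (hc : IsDigraphCycle A c) :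
    (∃ t, ∀ s, (c (t + s) : ℕ) = s) ∨ (∃ t, ∀ s, (c (t + s) : ℕ) + (m + 1) = n + s) := by
  obtain ⟨hinj, hpos⟩ := hc
  by_cases h0 : ∃ t, (c t : ℕ) = 0
  · left
    obtain ⟨t, ht⟩ := h0
    refine ⟨t, fun s => ?_⟩
    suffices H : ∀ r (hr : r < m + 1), (c (t + ⟨r, hr⟩) : ℕ) = r from H s s.isLt
    intro r
    induction r using Nat.strong_induction_on with
    | _ r ih =>
      intro hr
      match r, ih, hr with
      | 0, _, hr =>
        have : (⟨0, hr⟩ : Fin (m + 1)) = 0 := rfl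
        rw [this, add_zero, ht]
      | r + 1, ih, hr =>
        have hstep : t + (⟨r, by omega⟩ : Fin (m + 1)) + 1 = t + ⟨r + 1, hr⟩ := by
          rw [add_assoc]
          congr 1
          apply Fin.ext
          simp [Fin.val_add, Nat.mod_eq_of_lt hr]
        have hprev := ih r (by omega) (by omega)
        have harc := harcs _ _ (hpos (t + ⟨r, by omega⟩))
        rw [hstep, hprev] at harc
        by_contra hne
        -- An arc from `r` not going to `r + 1` ends at 0 or has `r` as last vertex; either way it
        -- returns to a vertex already visited, against injectivity.
        have hlt : (c (t + ⟨r + 1, hr⟩) : ℕ) < r + 1 := by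
          have := (c (t + ⟨r + 1, hr⟩)).isLt
          omega
        have heq := ih _ hlt (by omega)
        have := add_left_cancel (hinj (Fin.ext heq))
        have := congrArg Fin.val this
        simp only at this
        omega
  · right
    push Not at h0
    -- A cycle avoiding the first vertex can only descend from the last one, so its largest vertex
    -- is `n - 1`. The induction runs backwards along the cycle from there.
    obtain ⟨t, ht⟩ := Finite.exists_max fun s => (c s : ℕ)
    have htn : (c t : ℕ) + 1 = n := by
      rcases harcs _ _ (hpos t) with h | h | h
      · have := ht (t + 1)
        omega
      · exact absurd h (h0 _)
      · exact h
    refine ⟨t + 1, fun s => ?_⟩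
    suffices H : ∀ r (hr : r < m + 1), (c (t + 1 + ⟨m - r, by omega⟩) : ℕ) + (m + 1) =
        n + (m - r) by
      have h := H (m - s) (by omega)
      have hs : m - (m - (s : ℕ)) = s := by omega
      simpa only [hs] using h
    intro r
    induction r with
    | zero =>
      intro _
      have : t + 1 + (⟨m - 0, by omega⟩ : Fin (m + 1)) = t := by
        rw [add_assoc]
        have h1 : (1 : Fin (m + 1)) + ⟨m - 0, by omega⟩ = 0 := by
          apply Fin.ext
          simp [Fin.val_add, add_comm]
        rw [h1, add_zero]
      rw [this]
      omega
    | succ r ih =>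
      intro hr
      have ih' := ih (by omega)
      have hstep : t + 1 + (⟨m - (r + 1), by omega⟩ : Fin (m + 1)) + 1 =
          t + 1 + ⟨m - r, by omega⟩ := by
        rw [add_assoc _ _ (1 : Fin (m + 1))]
        congr 1
        apply Fin.ext
        have : m - (r + 1) + 1 = m - r := by omega
        have h2 : m - r < m + 1 := by omega
        simp [Fin.val_add, this, Nat.mod_eq_of_lt h2]
      have harc := harcs _ _ (hpos (t + 1 + ⟨m - (r + 1), by omega⟩))
      rw [hstep] at harc
      rcases harc with h | h | h
      · omega
      · exact absurd h (h0 _)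
      · have h1 : c (t + 1 + ⟨m - (r + 1), by omega⟩) = c t := Fin.ext (by omega)
        have h2 : t + 1 + (⟨m - (r + 1), by omega⟩ : Fin (m + 1)) + 1 = t + 1 := by
          rw [hinj h1]
        rw [hstep] at h2
        have h3 : (⟨m - r, by omega⟩ : Fin (m + 1)) = 0 := by
          simpa using h2
        have := congrArg Fin.val h3
        simp at this
        omega

theorem isSimpleEBL_eblMatrix (hu : ∀ r, 0 ≤ u r) (hv : ∀ r, 0 ≤ v r) :
    IsSimpleEBL (eblMatrix n u v) where
  nonneg := eblMatrix_nonneg hu hv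
  path := eblMatrix_succ
  arcs := eq_succ_or_of_eblMatrix_pos
  cycles := cycle_form_of_arcs eq_succ_or_of_eblMatrix_pos

/-- Irreducibility demands walks of positive length; the arc `h₀` supplies them, since reflexive
reachability alone admits a single vertex without a loop. -/
theorem isIrreducible_of_reflTransGen {A : Matrix (Fin n) (Fin n) ℝ} (hA : ∀ i j, 0 ≤ A i j)
    (h : ∀ i j, Relation.ReflTransGen (fun i j => 0 < A i j) i j) {i₀ j₀ : Fin n}
    (h₀ : 0 < A i₀ j₀) : A.IsIrreducible := by
  let : Quiver (Fin n) := A.toQuiver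
  refine ⟨hA, Quiver.IsStronglyConnected.isSStronglyConnected_of_hom (i₀ := i₀) (j₀ := j₀)
    ?_ ⟨h₀⟩⟩
  intro i j
  induction h i j with
  | refl => exact ⟨.nil⟩
  | tail _ e ih => exact ⟨ih.some.cons ⟨e⟩⟩

theorem reflTransGen_eblMatrix_of_le {i j : Fin n} (hij : i ≤ j) :
    Relation.ReflTransGen (fun i j => 0 < eblMatrix n u v i j) i j := by
  obtain ⟨d, hd⟩ := Nat.exists_eq_add_of_le (Fin.le_def.mp hij)
  induction d generalizing j with
  | zero =>
    rw [show j = i from Fin.ext (by omega)]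
  | succ d ih =>
    have hlt : (i : ℕ) + d < n := by omega
    refine (ih (j := ⟨i + d, hlt⟩) (Fin.le_def.mpr (by simp)) rfl).tail ?_
    rw [eblMatrix_succ _ _ (by simp only; omega)]
    exact one_pos

theorem eblMatrix_to_first_pos (hv : ∀ r, 0 ≤ v r) {i j : Fin n}
    (hj : (j : ℕ) = 0) (h : 0 < u (i + 1)) : 0 < eblMatrix n u v i j := by
  have h2 := hv (n - j)
  unfold eblMatrix
  rw [if_neg (by omega), if_pos hj]
  split_ifs <;> linarith

theorem eblMatrix_from_last_pos (hu : ∀ r, 0 ≤ u r) {i j : Fin n}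
    (hi : (i : ℕ) + 1 = n) (h : 0 < v (n - j)) : 0 < eblMatrix n u v i j := by
  have h2 := hu (i + 1)
  unfold eblMatrix
  rw [if_neg (by omega), if_pos hi]
  split_ifs <;> linarith

/-- An EBL digraph is strongly connected as soon as a walk leads back from its last to its first
vertex: by a single arc, or by an arc from the last vertex, a part of the path, and an arc to the
first vertex. -/
theorem isIrreducible_eblMatrix (hn : 0 < n) (hu : ∀ r, 0 ≤ u r) (hv : ∀ r, 0 ≤ v r)
    (h : 0 < u n ∨ ∃ r s, r ≤ n ∧ s ≤ n ∧ n < r + s ∧ 0 < u r ∧ 0 < v s) :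
    (eblMatrix n u v).IsIrreducible := by
  set first : Fin n := ⟨0, hn⟩ with hfirst
  set last : Fin n := ⟨n - 1, by omega⟩ with hlast
  have hback : Relation.TransGen (fun i j => 0 < eblMatrix n u v i j) last first := by
    rcases h with h | ⟨r, s, hr, hs, hrs, hur, hvs⟩
    · refine .single (eblMatrix_to_first_pos hv rfl ?_)
      rwa [hlast, Nat.sub_add_cancel hn]
    · have h1 : 0 < eblMatrix n u v last ⟨n - s, by omega⟩ := by
        refine eblMatrix_from_last_pos hu (Nat.sub_add_cancel hn) ?_
        simpa only [Nat.sub_sub_self hs] using hvs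
      have h2 : Relation.ReflTransGen (fun i j => 0 < eblMatrix n u v i j)
          (⟨n - s, by omega⟩ : Fin n) ⟨r - 1, by omega⟩ :=
        reflTransGen_eblMatrix_of_le (Fin.le_def.mpr (by simp only; omega))
      have h3 : 0 < eblMatrix n u v ⟨r - 1, by omega⟩ first := by
        refine eblMatrix_to_first_pos hv rfl ?_
        simpa only [Nat.sub_add_cancel (show 1 ≤ r by omega)] using hur
      exact Relation.TransGen.head' h1 (h2.tail h3)
  obtain ⟨w, _, hw⟩ := Relation.TransGen.tail'_iff.mp hback
  refine isIrreducible_of_reflTransGen (eblMatrix_nonneg hu hv) (fun i j => ?_) hw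
  exact ((reflTransGen_eblMatrix_of_le (Fin.le_def.mpr (by simp only [hlast]; omega))).trans
    hback.to_reflTransGen).trans
    (reflTransGen_eblMatrix_of_le (Fin.le_def.mpr (by simp [hfirst])))

end SimpleEBL

/-! ### Characteristic polynomial of an EBL digraph -/

section EBLCharpoly

variable {n : ℕ}

/-- `t • 1 - N`, where `N` is the adjacency matrix of the path `0 → 1 → ⋯ → n - 1`. -/
def pathCharMatrix (n : ℕ) (t : ℝ) : Matrix (Fin n) (Fin n) ℝ := fun i j =>
  (if i = j then t else 0) - if (j : ℕ) = i + 1 then 1 else 0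

/-- The inverse of `pathCharMatrix n t`. -/
noncomputable def pathResolvent (n : ℕ) (t : ℝ) : Matrix (Fin n) (Fin n) ℝ := fun i j =>
  if i ≤ j then t⁻¹ ^ ((j : ℕ) - i + 1) else 0

theorem det_pathCharMatrix (n : ℕ) (t : ℝ) : (pathCharMatrix n t).det = t ^ n := by
  rw [Matrix.det_of_isUpperTriangular]
  · simp [pathCharMatrix]
  · intro i j hij
    have h : (j : ℕ) < i := hij
    have h' : i ≠ j := by rintro rfl; omega
    simp only [pathCharMatrix]
    rw [if_neg h', if_neg (by omega), sub_zero]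

theorem pathResolvent_mul_pathCharMatrix {t : ℝ} (ht : t ≠ 0) :
    pathResolvent n t * pathCharMatrix n t = 1 := by
  ext i j
  rw [Matrix.mul_apply]
  simp only [pathCharMatrix, mul_sub, sum_sub_distrib, mul_ite, mul_zero, mul_one,
    sum_ite_eq', mem_univ, if_true]
  rw [Matrix.one_apply]
  by_cases hj : (j : ℕ) = 0
  · have h0 : ∑ x : Fin n, (if (j : ℕ) = x + 1 then pathResolvent n t i x else 0) = 0 :=
      sum_eq_zero fun x _ => if_neg (by omega)
    rw [h0, sub_zero, pathResolvent]
    by_cases hij : i = j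
    · subst hij
      simp [ht]
    · have : ¬ i ≤ j := by
        intro h
        have h' : (i : ℕ) ≤ j := h
        exact hij (Fin.ext (by omega))
      simp [hij, this]
  · have h0 : ∑ x : Fin n, (if (j : ℕ) = x + 1 then pathResolvent n t i x else 0) =
        pathResolvent n t i ⟨j - 1, by omega⟩ := by
      rw [sum_eq_single_of_mem (⟨j - 1, by omega⟩ : Fin n) (mem_univ _)]
      · rw [if_pos (by simp only; omega)]
      · intro x _ hx
        refine if_neg fun h => hx (Fin.ext ?_)
        simp only
        omega
    rw [h0, pathResolvent, pathResolvent]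
    simp only [Fin.le_def]
    rcases lt_trichotomy (i : ℕ) j with h | h | h
    · have hne : i ≠ j := by rintro rfl; omega
      rw [if_pos h.le, if_pos (by omega), if_neg hne,
        show (j : ℕ) - i + 1 = (j - 1 - i + 1) + 1 by omega, pow_succ, mul_assoc,
        inv_mul_cancel₀ ht]
      ring
    · have hij : i = j := Fin.ext h
      subst hij
      rw [if_pos le_rfl, if_neg (by omega), if_pos rfl]
      simp [ht]
    · have hne : i ≠ j := by rintro rfl; omega
      rw [if_neg (by omega), if_neg (by omega), if_neg hne]
      simp

/-- The columns `u` and `e_{n-1}`. -/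
def eblCols (n : ℕ) (u : ℕ → ℝ) : Matrix (Fin n) (Fin 2) ℝ := fun i =>
  ![u (i + 1), if (i : ℕ) + 1 = n then 1 else 0]

/-- The rows `e_0` and `v`. -/
def eblRows (n : ℕ) (v : ℕ → ℝ) : Matrix (Fin 2) (Fin n) ℝ :=
  ![fun j => if (j : ℕ) = 0 then 1 else 0, fun j => v (n - j)]

theorem scalar_sub_eblMatrix (u v : ℕ → ℝ) (t : ℝ) :
    Matrix.scalar (Fin n) t - eblMatrix n u v =
      pathCharMatrix n t - eblCols n u * eblRows n v := by
  ext i j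
  rw [Matrix.sub_apply, Matrix.sub_apply, Matrix.mul_apply, Fin.sum_univ_two]
  simp only [eblMatrix, pathCharMatrix, eblCols, eblRows, Matrix.scalar_apply, Matrix.diagonal_apply, Matrix.cons_val_zero,
    Matrix.cons_val_one, mul_ite, mul_one, mul_zero, ite_mul, one_mul, zero_mul]
  ring

/-- The arcs off the path form a perturbation of rank at most two, so the determinant identity for
`1 - B * C` and `1 - C * B` reduces the computation to a 2 × 2 determinant. -/
theorem eval_charpoly_eblMatrix_eq_det (u v : ℕ → ℝ) {t : ℝ} (ht : t ≠ 0) :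
    (eblMatrix n u v).charpoly.eval t =
      t ^ n * (1 - eblRows n v * (pathResolvent n t * eblCols n u)).det := by
  have h1 := pathResolvent_mul_pathCharMatrix (n := n) ht
  have h2 := mul_eq_one_comm.mp h1
  rw [Matrix.eval_charpoly, scalar_sub_eblMatrix, ← det_pathCharMatrix n t,
    ← Matrix.det_one_sub_mul_comm, ← Matrix.det_mul]
  congr 1
  rw [mul_sub, mul_one, Matrix.mul_assoc (pathResolvent n t), ← Matrix.mul_assoc, h2,
    Matrix.one_mul]

/-- The value of the characteristic polynomial of an EBL digraph: its linear subdigraphs are the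
single cycles and the disjoint pairs consisting of a cycle through the first and a cycle through
the last vertex. -/
theorem eval_charpoly_eblMatrix (hn : 0 < n) (u v : ℕ → ℝ) {t : ℝ} (ht : t ≠ 0) :
    (eblMatrix n u v).charpoly.eval t = t ^ n *
      (1 - ∑ r ∈ Icc 1 n, u r * t⁻¹ ^ r - ∑ s ∈ Icc 1 n, v s * t⁻¹ ^ s +
        ∑ r ∈ Icc 1 n, ∑ s ∈ Icc 1 n, if r + s ≤ n then u r * v s * t⁻¹ ^ (r + s) else 0) := by
  have hu_sum : ∀ f : ℕ → ℝ, ∑ i : Fin n, f (i + 1) = ∑ r ∈ Icc 1 n, f r := by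
    intro f
    rw [Fin.sum_univ_eq_sum_range (fun i => f (i + 1)) n, range_eq_Ico, sum_Ico_add' f 0 n 1]
    rfl
  have hv_sum : ∀ f : ℕ → ℝ, ∑ j : Fin n, f (n - j) = ∑ s ∈ Icc 1 n, f s := by
    intro f
    rw [← hu_sum, ← Equiv.sum_comp Fin.revPerm]
    refine sum_congr rfl fun j _ => ?_
    congr 1
    simp only [Fin.revPerm_apply, Fin.val_rev]
    omega
  have h00 : (eblRows n v * (pathResolvent n t * eblCols n u)) 0 0 =
      ∑ r ∈ Icc 1 n, u r * t⁻¹ ^ r := by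
    rw [← hu_sum, Matrix.mul_apply, sum_eq_single_of_mem (⟨0, hn⟩ : Fin n) (mem_univ _)]
    · simp only [eblRows, Matrix.cons_val_zero, if_true, one_mul, Matrix.mul_apply, eblCols,
        pathResolvent]
      refine sum_congr rfl fun i _ => ?_
      rw [if_pos (Fin.le_def.mpr (Nat.zero_le _)), Nat.sub_zero, mul_comm]
    · intro j _ hj
      have : (j : ℕ) ≠ 0 := fun h => hj (Fin.ext h)
      simp [eblRows, this]
  have hcol : ∀ j : Fin n, (pathResolvent n t * eblCols n u) j 1 = t⁻¹ ^ (n - j) := by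
    intro j
    rw [Matrix.mul_apply,
      sum_eq_single_of_mem (⟨n - 1, by omega⟩ : Fin n) (mem_univ _)]
    · simp only [eblCols, Matrix.cons_val_one, pathResolvent, Nat.sub_add_cancel hn, if_true]
      rw [if_pos (Fin.le_def.mpr (by simp only; omega)),
        show n - 1 - (j : ℕ) + 1 = n - j by omega]
      exact mul_one _
    · intro i _ hi
      have : (i : ℕ) + 1 ≠ n := fun h => hi (Fin.ext (by simp only; omega))
      simp [eblCols, this]
  have h01 : (eblRows n v * (pathResolvent n t * eblCols n u)) 0 1 = t⁻¹ ^ n := by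
    rw [Matrix.mul_apply, sum_eq_single_of_mem (⟨0, hn⟩ : Fin n) (mem_univ _)]
    · rw [hcol]
      simp [eblRows]
    · intro j _ hj
      have : (j : ℕ) ≠ 0 := fun h => hj (Fin.ext h)
      simp [eblRows, this]
  have h11 : (eblRows n v * (pathResolvent n t * eblCols n u)) 1 1 =
      ∑ s ∈ Icc 1 n, v s * t⁻¹ ^ s := by
    rw [← hv_sum, Matrix.mul_apply]
    refine sum_congr rfl fun j _ => ?_
    rw [hcol]
    simp [eblRows]
  -- The factor in front is the entry at `0 1`, so this is the off-diagonal product. It consists of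
  -- the overlapping pairs, `r + s > n`, and cancels them from the diagonal product.
  have h10 : t⁻¹ ^ n * (eblRows n v * (pathResolvent n t * eblCols n u)) 1 0 =
      ∑ r ∈ Icc 1 n, ∑ s ∈ Icc 1 n,
        if r + s ≤ n then 0 else u r * v s * t⁻¹ ^ (r + s) := by
    rw [← hu_sum, Matrix.mul_apply, mul_sum]
    simp_rw [← hv_sum, Matrix.mul_apply, mul_sum]
    rw [sum_comm]
    refine sum_congr rfl fun i _ => sum_congr rfl fun j _ => ?_
    simp only [eblRows, Matrix.cons_val_one, pathResolvent, eblCols, Matrix.cons_val_zero]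
    by_cases hji : j ≤ i
    · have h : (j : ℕ) ≤ i := hji
      rw [if_pos hji, if_neg (by omega), show (i : ℕ) + 1 + (n - j) = n + (i - j + 1) by omega,
        pow_add t⁻¹ n]
      ring
    · have h : (i : ℕ) < j := Fin.lt_def.mp (not_le.mp hji)
      rw [if_neg hji, if_pos (by omega)]
      ring
  have hsplit : (∑ r ∈ Icc 1 n, u r * t⁻¹ ^ r) * (∑ s ∈ Icc 1 n, v s * t⁻¹ ^ s) =
      (∑ r ∈ Icc 1 n, ∑ s ∈ Icc 1 n, if r + s ≤ n then u r * v s * t⁻¹ ^ (r + s) else 0) +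
      ∑ r ∈ Icc 1 n, ∑ s ∈ Icc 1 n, if r + s ≤ n then 0 else u r * v s * t⁻¹ ^ (r + s) := by
    rw [sum_mul_sum, ← sum_add_distrib]
    refine sum_congr rfl fun r _ => ?_
    rw [← sum_add_distrib]
    refine sum_congr rfl fun s _ => ?_
    split_ifs <;> ring
  rw [eval_charpoly_eblMatrix_eq_det u v ht, Matrix.det_fin_two]
  simp only [Matrix.sub_apply, Matrix.one_apply_eq, Matrix.one_apply_ne zero_ne_one,
    Matrix.one_apply_ne one_ne_zero, h00, h01, h11]
  congr 1
  linear_combination hsplit - h10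

theorem charpoly_eblMatrix_eq_oddGapPoly {p : ℕ} (hp : 3 ≤ p) {u v k : ℕ → ℝ}
    (hu : ∀ r < p, u r = 0) (hv : ∀ r < p, v r = 0)
    (hmid : ∀ j, p ≤ j → j < 2 * p → k j = -(u j + v j))
    (h2p : k (2 * p) = -(u (2 * p) + v (2 * p)) + u p * v p)
    (h2p1 : k (2 * p + 1) = -(u (2 * p + 1) + v (2 * p + 1)) +
      (u p * v (p + 1) + u (p + 1) * v p)) :
    (eblMatrix (2 * p + 1) u v).charpoly = oddGapPoly p k := by
  refine eq_of_infinite_eval_eq _ _ (Set.Infinite.mono (s := {0}ᶜ) (fun t ht => ?_)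
    (Set.finite_singleton (0 : ℝ)).infinite_compl)
  have ht : t ≠ 0 := ht
  rw [Set.mem_ofPred_eq, eval_charpoly_eblMatrix (by omega) u v ht]
  have hrestrict : ∀ w : ℕ → ℝ, (∀ r < p, w r = 0) →
      ∑ r ∈ Icc 1 (2 * p + 1), w r * t⁻¹ ^ r = ∑ r ∈ Icc p (2 * p + 1), w r * t⁻¹ ^ r := by
    intro w hw
    symm
    refine sum_subset (Icc_subset_Icc_left (by omega)) fun r _ hr => ?_
    rw [mem_Icc] at *
    rw [hw r (by omega), zero_mul]
  have hpairs : ∑ r ∈ Icc 1 (2 * p + 1), ∑ s ∈ Icc 1 (2 * p + 1),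
      (if r + s ≤ 2 * p + 1 then u r * v s * t⁻¹ ^ (r + s) else 0) =
      u p * v p * t⁻¹ ^ (2 * p) +
        (u p * v (p + 1) + u (p + 1) * v p) * t⁻¹ ^ (2 * p + 1) := by
    rw [← sum_product', ← sum_subset (s₁ := {(p, p), (p, p + 1), (p + 1, p)})]
    · rw [sum_insert (by simp), sum_insert (by simp), sum_singleton]
      simp only
      rw [if_pos (by omega), if_pos (by omega), if_pos (by omega)]
      ring
    · intro q hq
      simp only [mem_insert, mem_singleton] at hq
      rcases hq with rfl | rfl | rfl <;> simp <;> omega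
    · rintro ⟨r, s⟩ _ hq
      simp only [mem_insert, mem_singleton, Prod.mk.injEq] at hq
      split_ifs with hrs
      · rcases lt_or_ge r p with h | h
        · simp [hu r h]
        · rw [hv s (by simp only at hrs; omega)]
          simp
      · rfl
  have hpoly : (oddGapPoly p k).eval t =
      t ^ (2 * p + 1) * (1 + ∑ j ∈ Icc p (2 * p + 1), k j * t⁻¹ ^ j) := by
    rw [oddGapPoly, eval_add, eval_pow, eval_X, eval_finsetSum, mul_add, mul_one, mul_sum]
    congr 1
    refine sum_congr rfl fun j hj => ?_
    rw [eval_mul, eval_C, eval_pow, eval_X, ← Nat.sub_add_cancel (mem_Icc.mp hj).2, pow_add,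
      Nat.add_sub_cancel, inv_pow]
    field_simp
  have hk : ∑ j ∈ Icc p (2 * p + 1), k j * t⁻¹ ^ j =
      -∑ j ∈ Icc p (2 * p + 1), u j * t⁻¹ ^ j - ∑ j ∈ Icc p (2 * p + 1), v j * t⁻¹ ^ j +
      (u p * v p * t⁻¹ ^ (2 * p) +
        (u p * v (p + 1) + u (p + 1) * v p) * t⁻¹ ^ (2 * p + 1)) := by
    rw [sum_Icc_succ_top (by omega), sum_Icc_succ_top (by omega), sum_Icc_succ_top (by omega)]
    have hlast : Icc p (2 * p) = Icc p (2 * p - 1 + 1) := by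
      rw [Nat.sub_add_cancel (by omega)]
    rw [hlast, sum_Icc_succ_top (by omega), sum_Icc_succ_top (by omega),
      sum_Icc_succ_top (by omega), Nat.sub_add_cancel (by omega), h2p, h2p1]
    have hm : ∑ j ∈ Icc p (2 * p - 1), k j * t⁻¹ ^ j =
        -∑ j ∈ Icc p (2 * p - 1), u j * t⁻¹ ^ j - ∑ j ∈ Icc p (2 * p - 1), v j * t⁻¹ ^ j := by
      rw [← sum_neg_distrib, ← sum_sub_distrib]
      refine sum_congr rfl fun j hj => ?_
      rw [mem_Icc] at hj
      rw [hmid j hj.1 (by omega)]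
      ring
    rw [hm]
    ring
  rw [hpoly, hk, hpairs, hrestrict u hu, hrestrict v hv]
  ring

end EBLCharpoly

/-! ### Constructing realizations and identifying the exceptions -/

section Sufficiency

variable {p : ℕ} {k : ℕ → ℝ} {α : ℝ}

/-- A feasible polynomial is realized by an EBL digraph in which all cycles of length between
`p + 1` and `2 p` pass through the last vertex. -/
theorem exists_oneSided_simpleEBL (hp : 3 ≤ p) (h : FeasibleCoeffs p k α) :
    ∃ A : Matrix (Fin (2 * p + 1)) (Fin (2 * p + 1)) ℝ, IsSimpleEBL A ∧
      A.charpoly = oddGapPoly p k ∧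
      ((k (2 * p + 1) < -k (p + 1) * α ∨ 0 < α ∧ (k (2 * p) < α * (-k p - α) ∨
        ∃ j, p + 2 ≤ j ∧ j < 2 * p ∧ k j < 0)) → A.IsIrreducible) := by
  obtain ⟨hmid, hα, hαp, h2p, h2p1⟩ := h
  -- The disjoint pairs contribute `α * (-k p - α)` and `α * -k (p + 1)`; the surpluses over `k (2 *
  -- p)` and `k (2 * p + 1)` become weights of single cycles of these lengths.
  obtain ⟨u, hu_def⟩ : ∃ u : ℕ → ℝ, u = fun r => if r = p then α else
    if r = 2 * p + 1 then -k (p + 1) * α - k (2 * p + 1) else 0 := ⟨_, rfl⟩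
  obtain ⟨v, hv_def⟩ : ∃ v : ℕ → ℝ, v = fun r => if r = p then -k p - α else
    if p + 1 ≤ r ∧ r < 2 * p then -k r else
    if r = 2 * p then α * (-k p - α) - k (2 * p) else 0 := ⟨_, rfl⟩
  have hu : ∀ r, 0 ≤ u r := by
    intro r
    simp only [hu_def]
    split_ifs <;> linarith
  have hv : ∀ r, 0 ≤ v r := by
    intro r
    simp only [hv_def]
    split_ifs with h1 h2 h3
    · linarith
    · linarith [hmid r (by omega) h2.2]
    · linarith
    · exact le_rfl
  have hup : u p = α := by simp [hu_def]
  have hu_zero : ∀ r, r ≠ p → r ≠ 2 * p + 1 → u r = 0 := by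
    intro r h1 h2
    simp [hu_def, h1, h2]
  have hu_last : u (2 * p + 1) = -k (p + 1) * α - k (2 * p + 1) := by
    simp only [hu_def]
    rw [if_neg (by omega), if_pos trivial]
  have hvp : v p = -k p - α := by simp [hv_def]
  have hv_mid : ∀ r, p + 1 ≤ r → r < 2 * p → v r = -k r := by
    intro r h1 h2
    simp only [hv_def]
    rw [if_neg (by omega), if_pos ⟨h1, h2⟩]
  have hv_2p : v (2 * p) = α * (-k p - α) - k (2 * p) := by
    simp only [hv_def]
    rw [if_neg (by omega), if_neg (by omega), if_pos trivial]
  have hv_zero : ∀ r, r < p ∨ 2 * p < r → v r = 0 := by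
    intro r h
    simp only [hv_def]
    rw [if_neg (by omega), if_neg (by omega), if_neg (by omega)]
  refine ⟨eblMatrix (2 * p + 1) u v, isSimpleEBL_eblMatrix hu hv, ?_, fun hirr => ?_⟩
  · refine charpoly_eblMatrix_eq_oddGapPoly hp (fun r hr => hu_zero r (by omega) (by omega))
      (fun r hr => hv_zero r (Or.inl hr)) (fun j hj hj' => ?_) ?_ ?_
    · rcases hj.eq_or_lt with rfl | h
      · rw [hup, hvp]
        ring
      · rw [hu_zero j (by omega) (by omega), hv_mid j h hj']
        ring
    · rw [hu_zero (2 * p) (by omega) (by omega), hv_2p, hup, hvp]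
      ring
    · rw [hu_last, hv_zero (2 * p + 1) (Or.inr (by omega)), hup, hv_mid (p + 1) le_rfl (by omega),
        hu_zero (p + 1) (by omega) (by omega)]
      ring
  · refine isIrreducible_eblMatrix (by omega) hu hv ?_
    rcases hirr with h | ⟨hα0, h | ⟨j, hj, hj', hneg⟩⟩
    · left
      rw [hu_last]
      linarith
    · exact Or.inr ⟨p, 2 * p, by omega, by omega, by omega, by rwa [hup], by rw [hv_2p]; linarith⟩
    · exact Or.inr ⟨p, j, by omega, by omega, by omega, by rwa [hup],
        by rw [hv_mid j (by omega) hj']; linarith⟩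

/-- A polynomial which is feasible with `α = -k p / 2` is realized by an EBL digraph in which
the cycle weights of each length are balanced between the two ends. -/
theorem exists_balanced_simpleEBL (hp : 3 ≤ p) (h : FeasibleCoeffs p k (-k p / 2)) :
    ∃ A : Matrix (Fin (2 * p + 1)) (Fin (2 * p + 1)) ℝ, IsSimpleEBL A ∧
      A.charpoly = oddGapPoly p k ∧
      ((k (2 * p + 1) < -k (p + 1) * (-k p / 2) ∨ k (2 * p) < k p ^ 2 / 4 ∨
        ∃ j, p + 1 ≤ j ∧ j < 2 * p ∧ k j < 0) → A.IsIrreducible) := by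
  obtain ⟨hmid, hα, hαp, h2p, h2p1⟩ := h
  obtain ⟨v, hv_def⟩ : ∃ v : ℕ → ℝ, v = fun r =>
    if p ≤ r ∧ r < 2 * p then -k r / 2 else
    if r = 2 * p then (k p ^ 2 / 4 - k (2 * p)) / 2 else 0 := ⟨_, rfl⟩
  -- The even split gives pair weights `k p ^ 2 / 4` and `k p * k (p + 1) / 2`; only the Hamiltonian
  -- surplus is put on one side.
  obtain ⟨u, hu_def⟩ : ∃ u : ℕ → ℝ, u = fun r =>
    if r = 2 * p + 1 then -k (p + 1) * (-k p / 2) - k (2 * p + 1) else v r := ⟨_, rfl⟩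
  have hv : ∀ r, 0 ≤ v r := by
    intro r
    simp only [hv_def]
    split_ifs with h1 h2
    · linarith [hmid r h1.1 h1.2]
    · nlinarith
    · exact le_rfl
  have hu : ∀ r, 0 ≤ u r := by
    intro r
    have := hv r
    simp only [hu_def]
    split_ifs <;> linarith
  have hv_mid : ∀ r, p ≤ r → r < 2 * p → v r = -k r / 2 := by
    intro r h1 h2
    simp only [hv_def]
    rw [if_pos ⟨h1, h2⟩]
  have hv_2p : v (2 * p) = (k p ^ 2 / 4 - k (2 * p)) / 2 := by
    simp only [hv_def]
    rw [if_neg (by omega), if_pos trivial]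
  have hv_zero : ∀ r, r < p ∨ 2 * p < r → v r = 0 := by
    intro r h
    simp only [hv_def]
    rw [if_neg (by omega), if_neg (by omega)]
  have hu_last : u (2 * p + 1) = -k (p + 1) * (-k p / 2) - k (2 * p + 1) := by
    simp [hu_def]
  have huv : ∀ r, r ≤ 2 * p → u r = v r := by
    intro r hr
    simp only [hu_def]
    rw [if_neg (by omega)]
  refine ⟨eblMatrix (2 * p + 1) u v, isSimpleEBL_eblMatrix hu hv, ?_, fun hirr => ?_⟩
  · refine charpoly_eblMatrix_eq_oddGapPoly hp
      (fun r hr => (huv r (by omega)).trans (hv_zero r (Or.inl hr)))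
      (fun r hr => hv_zero r (Or.inl hr)) (fun j hj hj' => ?_) ?_ ?_
    · rw [huv j (by omega), hv_mid j hj hj']
      ring
    · rw [huv _ le_rfl, hv_2p, huv p (by omega), hv_mid p le_rfl (by omega)]
      ring
    · rw [hu_last, hv_zero (2 * p + 1) (Or.inr (by omega)), huv p (by omega),
        huv (p + 1) (by omega), hv_mid p le_rfl (by omega), hv_mid (p + 1) (by omega) (by omega)]
      ring
  · refine isIrreducible_eblMatrix (by omega) hu hv ?_
    rcases hirr with h | h | ⟨j, hj, hj', hneg⟩
    · left
      rw [hu_last]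
      linarith
    · refine Or.inr ⟨2 * p, 2 * p, by omega, by omega, by omega, ?_, ?_⟩
      · rw [huv _ le_rfl, hv_2p]
        linarith
      · rw [hv_2p]
        linarith
    · refine Or.inr ⟨j, j, by omega, by omega, by omega, ?_, ?_⟩
      · rw [huv j (by omega), hv_mid j (by omega) hj']
        linarith
      · rw [hv_mid j (by omega) hj']
        linarith

theorem oddGapPoly_eq_X_pow (h : ∀ j, p ≤ j → j ≤ 2 * p + 1 → k j = 0) :
    oddGapPoly p k = X ^ (2 * p + 1) := by
  rw [oddGapPoly, sum_eq_zero, add_zero]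
  intro j hj
  rw [mem_Icc] at hj
  rw [h j hj.1 hj.2, map_zero, zero_mul]

theorem FeasibleCoeffs.coeff_two_mul_le (h : FeasibleCoeffs p k α) :
    k (2 * p) ≤ k p ^ 2 / 4 := by
  have := h.2.2.2.1
  nlinarith [sq_nonneg (α + k p / 2)]

/-- `α * (-k p - α)` is largest at `-k p / 2`, so only the bound on `k (2 * p + 1)` has to be
required again. -/
theorem FeasibleCoeffs.half (h : FeasibleCoeffs p k α)
    (h2p1 : k (2 * p + 1) ≤ -k (p + 1) * (-k p / 2)) : FeasibleCoeffs p k (-k p / 2) := by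
  have h1 := h.coeff_two_mul_le
  obtain ⟨hmid, hα, hαp, -, -⟩ := h
  exact ⟨hmid, by linarith, by linarith, by linarith, h2p1⟩

/-- When `-k p / 2` is feasible, the balanced digraph fails to be strongly connected only in the
third configuration or for the excluded monomial. Otherwise `α > -k p / 2`, and failure of the
one-sided digraph makes both bounds tight: `α = -k p` is the first configuration, `α < -k p` the
second. -/
theorem exists_irreducible_simpleEBL (hp : 3 ≤ p) (hP : oddGapPoly p k ≠ X ^ (2 * p + 1))
    (h : FeasibleCoeffs p k α) (hexc : ¬ ExceptionalCoeffs p k) :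
    ∃ A : Matrix (Fin (2 * p + 1)) (Fin (2 * p + 1)) ℝ,
      A.IsIrreducible ∧ IsSimpleEBL A ∧ A.charpoly = oddGapPoly p k := by
  have hle := h.coeff_two_mul_le
  by_cases h2p1 : k (2 * p + 1) ≤ -k (p + 1) * (-k p / 2)
  · obtain ⟨A, hE, hch, hirr⟩ := exists_balanced_simpleEBL hp (h.half h2p1)
    refine ⟨A, hirr ?_, hE, hch⟩
    by_contra! hcon
    obtain ⟨h1, h2, h3⟩ := hcon
    have hmid : ∀ j, p + 1 ≤ j → j < 2 * p → k j = 0 := fun j hj hj' =>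
      (h.1 j (by omega) hj').antisymm (h3 j hj hj')
    have hb := hmid (p + 1) le_rfl (by omega)
    rw [hb, neg_zero, zero_mul] at h1 h2p1
    have hlast := h2p1.antisymm h1
    have h2p := hle.antisymm h2
    rcases (h.1 p le_rfl (by omega)).eq_or_lt with ha | ha
    · refine hP (oddGapPoly_eq_X_pow fun j hj hj' => ?_)
      rcases hj.eq_or_lt with rfl | hj
      · exact ha
      rcases lt_or_ge j (2 * p) with hj2 | hj2
      · exact hmid j hj hj2
      rcases hj2.eq_or_lt with rfl | hj2
      · rw [h2p, ha]
        norm_num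
      · rw [show j = 2 * p + 1 by omega, hlast]
    · exact hexc (Or.inr (Or.inr ⟨ha, fun j hj hj' => hmid j hj (by omega), h2p, hlast⟩))
  · obtain ⟨A, hE, hch, hirr⟩ := exists_oneSided_simpleEBL hp h
    refine ⟨A, hirr ?_, hE, hch⟩
    obtain ⟨hmid, hα, hαp, hk2p, hk2p1⟩ := h
    push Not at h2p1
    have hb0 := hmid (p + 1) (by omega) (by omega)
    have hb : k (p + 1) < 0 := by
      refine hb0.lt_of_ne fun h0 => ?_
      rw [h0] at h2p1 hk2p1
      linarith
    have hαgt : -k p / 2 < α := by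
      refine lt_of_mul_lt_mul_left (h2p1.trans_le hk2p1) (by linarith)
    have hα0 : 0 < α := by linarith
    have ha : k p < 0 := by linarith
    by_contra! hcon
    obtain ⟨h1, h2⟩ := hcon
    obtain ⟨h2, h3⟩ := h2 hα0
    have hlast := hk2p1.antisymm h1
    have h2p := hk2p.antisymm h2
    have hmid0 : ∀ j, p + 2 ≤ j → j < 2 * p → k j = 0 := fun j hj hj' =>
      (hmid j (by omega) hj').antisymm (h3 j hj hj')
    rcases hαp.eq_or_lt with heq | hlt
    · refine hexc (Or.inl ⟨ha, hb, fun j hj hj' => ?_, ?_⟩)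
      · rcases hj'.eq_or_lt with rfl | hj'
        · rw [h2p, heq]
          ring
        · exact hmid0 j hj hj'
      · rw [hlast, heq]
        ring
    · refine hexc (Or.inr (Or.inl ⟨ha, hb, fun j hj hj' => hmid0 j hj (by omega), ?_, ?_, ?_⟩))
      · rw [h2p]
        exact mul_pos hα0 (by linarith)
      · rw [h2p]
        nlinarith [sq_pos_of_pos (show 0 < α + k p / 2 by linarith)]
      -- `α` is the larger root of `x * (-k p - x) = k (2 * p)`, which fixes the sign of the square
      -- root.
      · have hsq : k p ^ 2 / 4 - k (2 * p) = (α + k p / 2) ^ 2 := by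
          rw [h2p]
          ring
        rw [hsq, Real.sqrt_sq (by linarith), hlast]
        ring

theorem ExceptionalCoeffs.exists_feasible (hp : 3 ≤ p) (h : ExceptionalCoeffs p k) :
    ∃ α, FeasibleCoeffs p k α := by
  rcases h with ⟨ha, hb, hmid, hlast⟩ | ⟨ha, hb, hmid, hpos, hlt, hlast⟩ | ⟨ha, hmid, h2p, hlast⟩
  · refine ⟨-k p, fun j hj hj' => ?_, by linarith, le_rfl, ?_, by rw [hlast]; linarith⟩
    · rcases hj.eq_or_lt with rfl | hj
      · exact ha.le
      rcases (Nat.succ_le_of_lt hj).eq_or_lt with rfl | hj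
      · exact hb.le
      exact (hmid j hj hj'.le).le
    · rw [hmid (2 * p) (by omega) le_rfl]
      linarith
  · have hsq := Real.sq_sqrt (show 0 ≤ k p ^ 2 / 4 - k (2 * p) by linarith)
    have hnn := Real.sqrt_nonneg (k p ^ 2 / 4 - k (2 * p))
    refine ⟨-k p / 2 + √(k p ^ 2 / 4 - k (2 * p)), fun j hj hj' => ?_, by linarith, ?_, ?_, ?_⟩
    · rcases hj.eq_or_lt with rfl | hj
      · exact ha.le
      rcases (Nat.succ_le_of_lt hj).eq_or_lt with rfl | hj
      · exact hb.le
      exact (hmid j hj (by omega)).le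
    · have : √(k p ^ 2 / 4 - k (2 * p)) ≤ -k p / 2 :=
        Real.sqrt_le_iff.mpr ⟨by linarith, by nlinarith⟩
      linarith
    · linarith
    · rw [hlast]
      linarith
  · refine ⟨-k p / 2, fun j hj hj' => ?_, by linarith, by linarith, by rw [h2p]; linarith, ?_⟩
    · rcases hj.eq_or_lt with rfl | hj
      · exact ha.le
      exact (hmid j hj (by omega)).le
    · rw [hlast, hmid (p + 1) le_rfl (by omega)]
      simp

theorem ExceptionalCoeffs.not_irreduciblyRealizable (hp : 3 ≤ p) (h : ExceptionalCoeffs p k) :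
    ¬ IrreduciblyRealizable (2 * p + 1) (oddGapPoly p k) := by
  rintro ⟨A, hirr, hch⟩
  rcases h with ⟨ha, hb, hmid, hlast⟩ | ⟨ha, hb, hmid, hpos, hlt, hlast⟩ | ⟨ha, hmid, h2p, hlast⟩
  · refine not_isIrreducible_of_coeff_succ_neg hp hch (s := -k p) hb
      (fun j hj hj' => hmid j hj (by omega)) (by linarith) ?_ (by rw [hlast]; ring) hirr
    rw [hmid (2 * p) (by omega) le_rfl]
    ring
  · have hsq := Real.sq_sqrt (show 0 ≤ k p ^ 2 / 4 - k (2 * p) by linarith)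
    have hpos' := Real.sqrt_pos.mpr (show 0 < k p ^ 2 / 4 - k (2 * p) by linarith)
    exact not_isIrreducible_of_coeff_succ_neg hp hch
      (s := -k p / 2 + √(k p ^ 2 / 4 - k (2 * p))) hb hmid (by linarith) (by linarith)
      (by rw [hlast]; ring) hirr
  · exact not_isIrreducible_of_coeff_two_mul_eq hp hch ha hmid h2p hlast hirr

end Sufficiency

/-! ### The main theorem -/

theorem theorem28 (p : ℕ) (hp : 3 ≤ p) (k : ℕ → ℝ)
    (hP : oddGapPoly p k ≠ Polynomial.X ^ (2 * p + 1)) :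
    (¬ ExceptionalCoeffs p k →
      (Realizable (2 * p + 1) (oddGapPoly p k) ↔
        IrreduciblyRealizable (2 * p + 1) (oddGapPoly p k))) ∧
    (ExceptionalCoeffs p k →
      Realizable (2 * p + 1) (oddGapPoly p k) ∧
        ¬ IrreduciblyRealizable (2 * p + 1) (oddGapPoly p k)) ∧
    (IrreduciblyRealizable (2 * p + 1) (oddGapPoly p k) →
      ∃ A : Matrix (Fin (2 * p + 1)) (Fin (2 * p + 1)) ℝ,
        A.IsIrreducible ∧ IsSimpleEBL A ∧ A.charpoly = oddGapPoly p k) := by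
  refine ⟨fun hexc => ⟨?_, ?_⟩, fun hexc => ⟨?_, hexc.not_irreduciblyRealizable hp⟩, ?_⟩
  · rintro ⟨A, hA, hch⟩
    obtain ⟨α, hα⟩ := exists_feasibleCoeffs_of_charpoly_eq hp hA hch
    obtain ⟨B, hB, -, hBch⟩ := exists_irreducible_simpleEBL hp hP hα hexc
    exact ⟨B, hB, hBch⟩
  · rintro ⟨A, hA, hch⟩
    exact ⟨A, hA.nonneg, hch⟩
  · obtain ⟨α, hα⟩ := hexc.exists_feasible hp
    obtain ⟨A, hE, hch, -⟩ := exists_oneSided_simpleEBL hp hα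
    exact ⟨A, hE.nonneg, hch⟩
  · intro hirr
    have hexc : ¬ ExceptionalCoeffs p k := fun h => h.not_irreduciblyRealizable hp hirr
    obtain ⟨A, hA, hch⟩ := hirr
    obtain ⟨α, hα⟩ := exists_feasibleCoeffs_of_charpoly_eq hp hA.nonneg hch
    exact exists_irreducible_simpleEBL hp hP hα hexc
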